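/- Let $I=[l,u]\subset\mathbb R$, $l<u$. A cookie-cutter map on $I$ is a map $F:\bigcup_{i=1}^q I_i\to I$, $q\ge 1$, where $I_1,\dots,I_q\subset I$ are pairwise disjoint closed intervals and each restriction $F:I_i\to I$ is an expanding ($|F'|>1$) $C^1$-diffeomorphism of $I_i$ onto $I$ (possibly orientation-reversing); it is of class $C^{1+\tau}$ if $F'$ is $\tau$-Hölder on each $I_i$. Its cookie-cutter set is $J(F)=\{x\in I:\ F^n(x)\text{ is defined for all }n\}$. Let $k\ge 1$, let $\mathbf a$ range over an arbitrary set of parameters, and for each $\mathbf a$ let $\mathcal F^{\mathbf a}=\{F_1^{\mathbf a},\dots,F_k^{\mathbf a}\}$ be a system of cookie-cutter maps on $I$ of class $C^{1+\tau}$ for some $\tau=\tau(\mathbf a)>0$. Let $c=(c_n)_{n\ge1}$ be a sequence in $\{1,\dots,k\}$, independent of $\mathbf a$, such that * (rare switching) $\#\{1\le m<n:\ c_m\ne c_{m+1}\}=o(n)$ as $n\to\infty$; * (frequencies condition) $\displaystyle\limsup_{n\to\infty}\tfrac1n\#\{1\le m\le n:\ c_m=j\}=1$ for every $j=1,\dots,k$.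 Put $J_c^{\mathbf a}=\{x\in I:\ (F^{\mathbf a}_{c_n}\circ\dots\circ F^{\mathbf a}_{c_1})(x)\text{ is defined for all }n\}$. Then for every parameter $\mathbf a$ the Hausdorff, lower box-counting and upper box-counting dimensions of each $J(F_j^{\mathbf a})$ coincide (denote the common value by $\dim J(F_j^{\mathbf a})$), and $$\dim_H J_c^{\mathbf a}=\min_{1\le j\le k}\dim J(F_j^{\mathbf a}),\qquad \overline{\dim}_B\, J_c^{\mathbf a}=\max_{1\le j\le k}\dim J(F_j^{\mathbf a}).$$ -/

import Mathlib

open Set Filter Topology MeasureTheory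
open scoped NNReal ENNReal

/-- A cookie-cutter map on the closed interval `I = [l, u]`: pairwise disjoint closed subintervals
`I_i = [left i, right i]` of `I`, finitely many and at least one, and a map `F : ⋃ i, I_i → I` each
of whose restrictions `F : I_i → I` is an expanding `C¹` diffeomorphism onto `I`, orientation
preserving or reversing. The values of `toFun` outside `⋃ i, I_i` carry no meaning. -/
structure CookieCutterMap (l u : ℝ) where
  /-- the number of branches -/
  q : ℕ
  q_pos : 0 < q
  left : Fin q → ℝ
  right : Fin q → ℝ
  left_lt_right : ∀ i, left i < right i
  subset : ∀ i, Icc (left i) (right i) ⊆ Icc l u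
  disjoint : ∀ i j, i ≠ j → Disjoint (Icc (left i) (right i)) (Icc (left j) (right j))
  toFun : ℝ → ℝ
  bijOn : ∀ i, BijOn toFun (Icc (left i) (right i)) (Icc l u)
  contDiffOn : ∀ i, ContDiffOn ℝ 1 toFun (Icc (left i) (right i))
  expanding : ∀ i, ∀ x ∈ Icc (left i) (right i),
    1 < |derivWithin toFun (Icc (left i) (right i)) x|

namespace CookieCutterMap

/-- The set `⋃ i, I_i` on which the cookie-cutter map is defined. -/
def domain {l u : ℝ} (F : CookieCutterMap l u) : Set ℝ :=
  ⋃ i, Icc (F.left i) (F.right i)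

/-- The cookie-cutter map is of class `C^{1+τ}`: on each `I_i` its derivative is `τ`-Hölder. -/
def IsC1Holder {l u : ℝ} (F : CookieCutterMap l u) (τ : ℝ≥0) : Prop :=
  ∀ i, ∃ C : ℝ≥0, HolderOnWith C τ
    (derivWithin F.toFun (Icc (F.left i) (F.right i))) (Icc (F.left i) (F.right i))

/-- The cookie-cutter set `J(F)`: the points of `I` at which all iterates of `F` are defined. -/
def cookieCutterSet {l u : ℝ} (F : CookieCutterMap l u) : Set ℝ :=
  {x | x ∈ Icc l u ∧ ∀ n : ℕ, F.toFun^[n] x ∈ F.domain}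

end CookieCutterMap

/-- The orbit of `x` under the maps `F (c 0), F (c 1), …` applied successively:
`seqOrbit F c n x = (F (c (n - 1)) ∘ ⋯ ∘ F (c 0)) x`. -/
def seqOrbit {l u : ℝ} {k : ℕ} (F : Fin k → CookieCutterMap l u) (c : ℕ → Fin k) :
    ℕ → ℝ → ℝ
  | 0, x => x
  | n + 1, x => (F (c n)).toFun (seqOrbit F c n x)

/-- The cookie-cutter-like set `J(F; c)`: the points of `I` at which all the compositions
`F (c n) ∘ ⋯ ∘ F (c 0)` are defined. -/
def cookieCutterLikeSet {l u : ℝ} {k : ℕ} (F : Fin k → CookieCutterMap l u) (c : ℕ → Fin k) :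
    Set ℝ :=
  {x | x ∈ Icc l u ∧ ∀ n : ℕ, seqOrbit F c n x ∈ (F (c n)).domain}

/-- The number of switches among the first `n` terms `c 0, …, c (n - 1)`. -/
def switchCount {k : ℕ} (c : ℕ → Fin k) (n : ℕ) : ℕ :=
  ((Finset.range n).filter fun m => m + 1 < n ∧ c m ≠ c (m + 1)).card

/-- The sequence `c` switches rarely: the number of switches up to time `n` is `o(n)`. -/
def SwitchesRarely {k : ℕ} (c : ℕ → Fin k) : Prop :=
  (fun n : ℕ => (switchCount c n : ℝ)) =o[atTop] (fun n : ℕ => (n : ℝ))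

/-- The frequency of the index `j` among the first `n` terms `c 0, …, c (n - 1)`. -/
noncomputable def freq {k : ℕ} (c : ℕ → Fin k) (n : ℕ) (j : Fin k) : ℝ :=
  (((Finset.range n).filter fun m => c m = j).card : ℝ) / n

/-- The frequencies condition: the upper frequency of every index is `1`. -/
def FrequenciesCondition {k : ℕ} (c : ℕ → Fin k) : Prop :=
  ∀ j : Fin k, limsup (fun n : ℕ => freq c n j) atTop = 1

/-- `log N_δ(S) / (-log δ)`, where `N_δ(S)` is the least number of closed balls of radius `δ`
that cover `S`; it is nonnegative for nonempty `S` and `δ < 1` (and `toENNReal` truncates it to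
`0` otherwise). -/
noncomputable def boxRatio (S : Set ℝ) (δ : ℝ≥0) : ℝ≥0∞ :=
  (ENNReal.log (Metric.externalCoveringNumber δ S : ℝ≥0∞) /
    ((-Real.log (δ : ℝ) : ℝ) : EReal)).toENNReal

/-- Upper box-counting dimension. -/
noncomputable def upperBoxDim (S : Set ℝ) : ℝ≥0∞ :=
  limsup (boxRatio S) (𝓝[>] 0)

/-- Lower box-counting dimension. -/
noncomputable def lowerBoxDim (S : Set ℝ) : ℝ≥0∞ :=
  liminf (boxRatio S) (𝓝[>] 0)

/-! The inverse branches of all the `F_j` form one finite family of uniform contractions labelled by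
`j`. Hölder derivatives give bounded distortion along every word, labels mixed or not, so the
relative size `ratio w` of a cylinder is multiplicative up to a constant `D`. Hence the partition
sums `Z s c n = ∑ (ratio w) ^ s` over words with labels `c 0, …, c (n - 1)` satisfy `Z (n + m) ≈ Z n
* Z m` (the second factor for the shifted sequence), up to the factor `D ^ s`.

The gaps between branches of the same map let `Z` control the dimensions of the limit set. If `Z <
1` infinitely often, then `dimH ≤ s` (`dimH_limitSet_le`); if `Z` is bounded below, then `dimH ≥ s`
by a mass distribution argument (`le_dimH_limitSet`); if `Z` is summable, the upper box dimension is
at most `s` (`upperBoxDim_limitSet_le`); if `Z` is unbounded, it is at least `s`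
(`le_upperBoxDim_limitSet`).

Along a constant sequence `j`, `Z` decays exponentially above an exponent `critExp j` and grows
exponentially below it, so all dimensions of `J(F_j)` equal `critExp j`. A rarely switching `c`
consists of `o(n)` constant runs up to time `n`. Cutting at the switches costs a constant per run,
hence only `exp(o(n))`, so exponential behaviour common to all labels survives: `Z` is summable
above the maximal exponent and bounded below under the minimal one. At the infinitely many times
when `j` has frequency near `1`, the sum behaves as for `j` alone, so `Z` is small infinitely often
if `s > critExp j` and large infinitely often if `s < critExp j`. These four facts give the minimum
and the maximum. Upper and lower estimates share the same lemmas on runs, applied to `Z` and to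
`Z⁻¹`. -/

/-! ### Covering numbers and box dimensions -/

theorem EReal.toENNReal_le_ofReal_iff {a : EReal} {s : ℝ} (hs : 0 ≤ s) :
    a.toENNReal ≤ ENNReal.ofReal s ↔ a ≤ (s : EReal) := by
  have e : ENNReal.ofReal s = (s : EReal).toENNReal := by simp [EReal.toENNReal]
  rw [e]
  constructor
  · intro h
    by_contra! hlt
    exact (EReal.toENNReal_lt_toENNReal (by exact_mod_cast hs) hlt).not_ge h
  · exact EReal.toENNReal_le_toENNReal

theorem exists_isCover_encard_eq_externalCoveringNumber (δ : ℝ≥0) (S : Set ℝ) :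
    ∃ C : Set ℝ, Metric.IsCover δ S C ∧ C.encard = Metric.externalCoveringNumber δ S := by
  have : Nonempty {C : Set ℝ // Metric.IsCover δ S C} := ⟨⟨S, Metric.IsCover.rfl⟩⟩
  have h := ciInf_mem fun C : {C : Set ℝ // Metric.IsCover δ S C} => C.1.encard
  obtain ⟨C, hC⟩ := h
  exact ⟨C.1, C.2, hC.trans (by rw [Metric.externalCoveringNumber, iInf_subtype])⟩

/-- Reduces dimension bounds to power bounds on covering numbers. The condition `δ < 1` makes the
denominator positive, and `0 ≤ s` makes the truncation by `toENNReal` harmless. -/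
theorem boxRatio_le_iff {S : Set ℝ} {s : ℝ} (hs : 0 ≤ s) {δ : ℝ≥0} (h0 : 0 < δ) (h1 : δ < 1) :
    boxRatio S δ ≤ ENNReal.ofReal s ↔
      (Metric.externalCoveringNumber δ S : ℝ≥0∞) ≤ ENNReal.ofReal ((δ : ℝ) ^ (-s)) := by
  have h0' : (0 : ℝ) < δ := h0
  have hlog : 0 < -Real.log (δ : ℝ) := by
    have := Real.log_neg h0' (by exact_mod_cast h1)
    linarith
  rw [boxRatio, EReal.toENNReal_le_ofReal_iff hs,
    EReal.div_le_iff_le_mul (by exact_mod_cast hlog) (EReal.coe_ne_top _),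
    ← ENNReal.log_le_log_iff, ENNReal.log_ofReal_of_pos (Real.rpow_pos_of_pos h0' _),
    Real.log_rpow h0', ← EReal.coe_mul]
  ring_nf

theorem tendsto_coe_nhdsGT_zero :
    Tendsto (fun δ : ℝ≥0 => (δ : ℝ)) (𝓝[>] 0) (𝓝[>] 0) := by
  refine tendsto_nhdsWithin_iff.2 ⟨?_, ?_⟩
  · exact (NNReal.continuous_coe.tendsto 0).mono_left nhdsWithin_le_nhds
  · filter_upwards [self_mem_nhdsWithin] with δ hδ
    exact_mod_cast hδ

theorem eventually_lt_nhdsGT_zero {r : ℝ≥0} (hr : 0 < r) :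
    ∀ᶠ δ : ℝ≥0 in 𝓝[>] 0, 0 < δ ∧ δ < r := by
  filter_upwards [Ioo_mem_nhdsGT hr] with δ hδ using hδ

theorem le_ofReal_of_forall_lt {x : ℝ≥0∞} {s : ℝ} (h : ∀ t, s < t → x ≤ ENNReal.ofReal t) :
    x ≤ ENNReal.ofReal s := by
  refine ge_of_tendsto (f := fun t : ℝ => ENNReal.ofReal t) (x := 𝓝[>] s) ?_ ?_
  · exact (ENNReal.continuous_ofReal.tendsto s).mono_left nhdsWithin_le_nhds
  · filter_upwards [self_mem_nhdsWithin] with t ht using h t ht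

theorem ofReal_le_of_forall_lt {x : ℝ≥0∞} {s : ℝ}
    (h : ∀ t, 0 < t → t < s → ENNReal.ofReal t ≤ x) : ENNReal.ofReal s ≤ x := by
  refine le_of_tendsto (f := fun t : ℝ => ENNReal.ofReal t) (x := 𝓝[<] s) ?_ ?_
  · exact (ENNReal.continuous_ofReal.tendsto s).mono_left nhdsWithin_le_nhds
  · filter_upwards [self_mem_nhdsWithin] with t ht
    rcases le_or_gt t 0 with h0 | h0
    · rw [ENNReal.ofReal_of_nonpos h0]
      exact zero_le
    · exact h t h0 ht

/-- The constant `C` is absorbed by passing to `t > s`, since `C * δ ^ (t - s)` tends to `0`. -/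
theorem upperBoxDim_le_of_eventually {S : Set ℝ} {s C : ℝ} (hs : 0 ≤ s)
    (h : ∀ᶠ δ : ℝ≥0 in 𝓝[>] 0, (Metric.externalCoveringNumber δ S : ℝ≥0∞) ≤
      ENNReal.ofReal (C * (δ : ℝ) ^ (-s))) :
    upperBoxDim S ≤ ENNReal.ofReal s := by
  refine le_ofReal_of_forall_lt fun t ht => ?_
  refine limsup_le_of_le (by isBoundedDefault) ?_
  have hsmall : ∀ᶠ δ : ℝ≥0 in 𝓝[>] 0, C * (δ : ℝ) ^ (t - s) < 1 := by
    have h1 : Tendsto (fun x : ℝ => C * x ^ (t - s)) (𝓝 0) (𝓝 (C * 0 ^ (t - s))) :=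
      ((Real.continuous_rpow_const (by linarith)).tendsto 0).const_mul C
    rw [Real.zero_rpow (by linarith), mul_zero] at h1
    exact ((h1.mono_left nhdsWithin_le_nhds).comp tendsto_coe_nhdsGT_zero).eventually_lt_const
      one_pos
  filter_upwards [h, hsmall, eventually_lt_nhdsGT_zero one_pos] with δ h₁ h₂ h₃
  rw [boxRatio_le_iff (by linarith) h₃.1 h₃.2]
  refine h₁.trans (ENNReal.ofReal_le_ofReal ?_)
  have h0 : (0 : ℝ) < δ := h₃.1
  have e : (δ : ℝ) ^ (-s) = (δ : ℝ) ^ (t - s) * (δ : ℝ) ^ (-t) := by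
    rw [← Real.rpow_add h0]; ring_nf
  rw [e, ← mul_assoc]
  exact mul_le_of_le_one_left (Real.rpow_nonneg h0.le _) h₂.le

theorem eventually_covering_le_of_upperBoxDim_lt {S : Set ℝ} {s : ℝ} (hs : 0 ≤ s)
    (h : upperBoxDim S < ENNReal.ofReal s) :
    ∀ᶠ δ : ℝ≥0 in 𝓝[>] 0, (Metric.externalCoveringNumber δ S : ℝ≥0∞) ≤
      ENNReal.ofReal ((δ : ℝ) ^ (-s)) := by
  filter_upwards [eventually_lt_of_limsup_lt h, eventually_lt_nhdsGT_zero one_pos] with δ h₁ h₂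
  exact (boxRatio_le_iff hs h₂.1 h₂.2).1 h₁.le

theorem lowerBoxDim_le_upperBoxDim (S : Set ℝ) : lowerBoxDim S ≤ upperBoxDim S :=
  liminf_le_limsup

/-- For `lowerBoxDim S < r < t < dimH S` there are arbitrarily small `δ` with a cover by at most `δ
^ (-r)` balls of radius `δ`. Their `t`-sum is at most `2 ^ t * δ ^ (t - r)`, which tends to `0`; but
`μH[t] S = ⊤` for `t < dimH S`. -/
theorem dimH_le_lowerBoxDim (S : Set ℝ) : dimH S ≤ lowerBoxDim S := by
  by_contra! hlt
  obtain ⟨r, hr₁, hr₂⟩ := ENNReal.lt_iff_exists_nnreal_btwn.1 hlt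
  obtain ⟨t, ht₁, ht₂⟩ := ENNReal.lt_iff_exists_nnreal_btwn.1 hr₂
  have hrt : (r : ℝ) < t := by exact_mod_cast ht₁
  have hfreq : ∃ᶠ δ : ℝ≥0 in 𝓝[>] 0, 0 < δ ∧ (Metric.externalCoveringNumber δ S : ℝ≥0∞) ≤
      ENNReal.ofReal ((δ : ℝ) ^ (-(r : ℝ))) := by
    refine ((frequently_lt_of_liminf_lt (by isBoundedDefault) hr₁).and_eventually
      (eventually_lt_nhdsGT_zero one_pos)).mono fun δ h => ⟨h.2.1, ?_⟩
    refine (boxRatio_le_iff r.2 h.2.1 h.2.2).1 ?_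
    simpa using h.1.le
  obtain ⟨d, hd, hcov⟩ := exists_seq_forall_of_frequently hfreq
  have hcover : ∀ n, ∃ C : Set ℝ, Metric.IsCover (d n) S C ∧
      (C.encard : ℝ≥0∞) ≤ ENNReal.ofReal ((d n : ℝ) ^ (-(r : ℝ))) := by
    intro n
    obtain ⟨C, hC, hCe⟩ := exists_isCover_encard_eq_externalCoveringNumber (d n) S
    exact ⟨C, hC, hCe ▸ (hcov n).2⟩
  choose C hC hCe using hcover
  have hfin : ∀ n, (C n).Finite := by
    intro n
    rw [← Set.encard_lt_top_iff]
    have := (hCe n).trans_lt ENNReal.ofReal_lt_top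
    exact_mod_cast this
  have hcount : ∀ n, Countable (C n) := fun n => (hfin n).countable.to_subtype
  have hd0 : Tendsto d atTop (𝓝 0) := hd.mono_right nhdsWithin_le_nhds
  have hle := Measure.hausdorffMeasure_le_liminf_tsum (X := ℝ) (ι := fun n => C n) (l := atTop) (t : ℝ) S
    (r := fun n => 2 * (d n : ℝ≥0∞)) (by
      have : Tendsto (fun n => 2 * (d n : ℝ≥0∞)) atTop (𝓝 (2 * ((0 : ℝ≥0) : ℝ≥0∞))) :=
        ENNReal.Tendsto.const_mul (ENNReal.tendsto_coe.2 hd0) (Or.inr (by simp))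
      simpa using this)
    (fun n i => Metric.closedEBall (i : ℝ) (d n))
    (Eventually.of_forall fun n i => Metric.ediam_closedEBall_le)
    (Eventually.of_forall fun n x hx => by
      obtain ⟨y, hy, hxy⟩ := hC n hx
      exact mem_iUnion.2 ⟨⟨y, hy⟩, hxy⟩)
  have hbound : ∀ n, ∑' i : C n, Metric.ediam (Metric.closedEBall (i : ℝ) (d n)) ^ (t : ℝ) ≤
      ENNReal.ofReal (2 ^ (t : ℝ) * (d n : ℝ) ^ ((t : ℝ) - r)) := by
    intro n
    have h0 : (0 : ℝ) < d n := (hcov n).1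
    calc ∑' i : C n, Metric.ediam (Metric.closedEBall (i : ℝ) (d n)) ^ (t : ℝ)
        ≤ ∑' _ : C n, (2 * (d n : ℝ≥0∞)) ^ (t : ℝ) := by
          gcongr
          exact Metric.ediam_closedEBall_le
      _ = (C n).encard * (2 * (d n : ℝ≥0∞)) ^ (t : ℝ) := by
          rw [ENNReal.tsum_const, ENat.card_coe_set_eq]
      _ ≤ ENNReal.ofReal ((d n : ℝ) ^ (-(r : ℝ))) * ENNReal.ofReal ((2 * d n : ℝ) ^ (t : ℝ)) := by
          refine mul_le_mul' (hCe n) (le_of_eq ?_)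
          rw [← ENNReal.ofReal_rpow_of_nonneg (mul_nonneg zero_le_two h0.le) (NNReal.coe_nonneg t),
            ENNReal.ofReal_mul zero_le_two, ENNReal.ofReal_coe_nnreal, ENNReal.ofReal_ofNat]
      _ = _ := by
          rw [← ENNReal.ofReal_mul (by positivity), Real.mul_rpow zero_le_two h0.le,
            sub_eq_add_neg, Real.rpow_add h0]
          ring_nf
  have hlim : Tendsto (fun n => ENNReal.ofReal (2 ^ (t : ℝ) * (d n : ℝ) ^ ((t : ℝ) - r))) atTop
      (𝓝 0) := by
    have h1 : Tendsto (fun x : ℝ => ENNReal.ofReal (2 ^ (t : ℝ) * x ^ ((t : ℝ) - r))) (𝓝 0)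
        (𝓝 (ENNReal.ofReal (2 ^ (t : ℝ) * 0 ^ ((t : ℝ) - r)))) :=
      (ENNReal.continuous_ofReal.comp ((Real.continuous_rpow_const
        (by linarith)).const_mul _)).tendsto 0
    rw [Real.zero_rpow (by linarith), mul_zero, ENNReal.ofReal_zero] at h1
    exact h1.comp ((NNReal.continuous_coe.tendsto 0).comp hd0)
  have hzero : μH[t] S ≤ 0 := by
    refine hle.trans ((liminf_le_liminf (Eventually.of_forall hbound)).trans ?_)
    rw [hlim.liminf_eq]
  have htop := hausdorffMeasure_of_lt_dimH ht₂
  simp [htop] at hzero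

/-! ### Submultiplicative functionals along rarely switching sequences -/

/-- Each further block of length `n₀` gains the factor `D * a n₀ < 1`; the remainder modulo `n₀`
takes finitely many values. -/
theorem exists_exp_decay_of_submultiplicative {a : ℕ → ℝ} (ha : ∀ n, 0 ≤ a n) {D : ℝ}
    (hmul : ∀ n m, a (n + m) ≤ D * a n * a m) {n₀ : ℕ} (hn₀ : 0 < n₀)
    (hsmall : D * a n₀ < 1) :
    ∃ C b : ℝ, 1 ≤ C ∧ 0 < b ∧ ∀ m : ℕ, a m ≤ C * Real.exp (-b * m) := by
  -- The lower bound `1 / 2` keeps `β` positive, so that `log β` is a genuine negative rate.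
  set β := max (D * a n₀) (1 / 2) with hβ
  have hβ0 : 0 < β := lt_of_lt_of_le (by norm_num) (le_max_right _ _)
  have hβ1 : β < 1 := max_lt hsmall (by norm_num)
  set M := 1 + ∑ i ∈ Finset.range n₀, a i with hM
  have hsum : 0 ≤ ∑ i ∈ Finset.range n₀, a i := Finset.sum_nonneg fun i _ => ha i
  have hstep : ∀ k r, r < n₀ → a (r + n₀ * k) ≤ M * β ^ k := by
    intro k r hr
    induction k with
    | zero =>
      have := Finset.single_le_sum (f := a) (fun i _ => ha i) (Finset.mem_range.2 hr)
      simp only [mul_zero, add_zero, pow_zero, mul_one]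
      linarith
    | succ k ih =>
      have e : r + n₀ * (k + 1) = n₀ + (r + n₀ * k) := by ring
      calc a (r + n₀ * (k + 1)) ≤ D * a n₀ * a (r + n₀ * k) := by rw [e]; exact hmul _ _
        _ ≤ β * (M * β ^ k) := mul_le_mul (le_max_left _ _) ih (ha _) hβ0.le
        _ = M * β ^ (k + 1) := by ring
  have hlog : Real.log β < 0 := Real.log_neg hβ0 hβ1
  have hn₀' : (0 : ℝ) < n₀ := by exact_mod_cast hn₀
  -- Dividing `M` by `β` pays for rounding `m / n₀` down.
  refine ⟨M / β, -Real.log β / n₀, ?_, div_pos (by linarith) hn₀', fun m => ?_⟩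
  · rw [le_div_iff₀ hβ0]; linarith
  · have h1 := hstep (m / n₀) (m % n₀) (Nat.mod_lt _ hn₀)
    rw [Nat.mod_add_div] at h1
    refine h1.trans ?_
    have h2 : β ^ (m / n₀) = Real.exp (Real.log β * (m / n₀ : ℕ)) := by
      rw [← Real.rpow_natCast, Real.rpow_def_of_pos hβ0]
    have h3 : M / β = M * Real.exp (-Real.log β) := by
      rw [Real.exp_neg, Real.exp_log hβ0]; rfl
    rw [h2, h3, mul_assoc, ← Real.exp_add]
    refine mul_le_mul_of_nonneg_left (Real.exp_le_exp.2 ?_) (by linarith)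
    have h4 : (m : ℝ) < n₀ * ((m / n₀ : ℕ) + 1) := by exact_mod_cast Nat.lt_mul_div_succ m hn₀
    have h5 : (m : ℝ) / n₀ ≤ (m / n₀ : ℕ) + 1 := by
      rw [div_le_iff₀ hn₀']; linarith
    have e : -(-Real.log β / n₀) * m = Real.log β * (m / n₀) := by ring
    rw [e]
    nlinarith

section Runs

variable {k : ℕ}

/-- A switch from `p` to `p + 1` is counted only up to times greater than `p + 1`, so it is absent
from the count at time `p + 1` itself. -/
theorem switchCount_lt_of_ne {c : ℕ → Fin k} {p n : ℕ} (hpn : p + 1 < n)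
    (hne : c p ≠ c (p + 1)) : switchCount c (p + 1) < switchCount c n := by
  refine Finset.card_lt_card (Finset.ssubset_iff_of_subset ?_ |>.2 ⟨p, ?_, ?_⟩)
  · intro m
    simp only [Finset.mem_filter, Finset.mem_range]
    omega
  · simp only [Finset.mem_filter, Finset.mem_range]
    exact ⟨by omega, hpn, hne⟩
  · simp

/-- A submultiplicative functional of finite words is bounded on a word by its bounds on constant
words, up to a factor that is exponential in the number of switches. -/
theorem le_pow_switchCount_mul_exp {a : (ℕ → Fin k) → ℕ → ℝ} (ha : ∀ c n, 0 ≤ a c n)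
    (hcongr : ∀ c c' n, (∀ i < n, c i = c' i) → a c n = a c' n) {D C : ℝ} (hD : 1 ≤ D)
    (hC : 1 ≤ C) (hmul : ∀ c n m, a c (n + m) ≤ D * a c n * a (fun i => c (n + i)) m)
    {β : Fin k → ℝ} (hβ : ∀ i (m : ℕ), a (fun _ => i) m ≤ C * Real.exp (β i * m))
    (c : ℕ → Fin k) (n : ℕ) :
    a c n ≤ (D * C) ^ (switchCount c n + 1) * Real.exp (∑ i ∈ Finset.range n, β (c i)) := by
  have hDC : 1 ≤ D * C := one_le_mul_of_one_le_of_one_le hD hC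
  have hrun : ∀ p m : ℕ, ∀ j, (∀ i < m, c (p + i) = j) →
      a (fun i => c (p + i)) m ≤ C * Real.exp (∑ i ∈ Finset.range m, β (c (p + i))) := by
    intro p m j hj
    rw [hcongr _ (fun _ => j) m hj, Finset.sum_congr rfl
      fun i hi => by rw [hj i (Finset.mem_range.1 hi)]]
    simpa [mul_comm] using hβ j m
  induction n using Nat.strong_induction_on with
  | _ n ih =>
    rcases Nat.eq_zero_or_pos n with rfl | hn
    · have h1 := hrun 0 0 (c 0) (by simp)
      rw [hcongr (fun i => c (0 + i)) c 0 (by simp)] at h1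
      refine h1.trans ?_
      simp only [Finset.range_zero, Finset.sum_empty, Real.exp_zero, mul_one]
      calc C ≤ D * C := le_mul_of_one_le_left (by linarith) hD
        _ ≤ _ := le_self_pow₀ hDC (by omega)
    classical
    -- The least such `p` is the start of the last constant run before time `n`. If `p > 0`,
    -- minimality forces a switch just before `p`, which pays for the extra factor `D * C`.
    have hex : ∃ p, p < n ∧ ∀ i < n - p, c (p + i) = c (n - 1) := by
      refine ⟨n - 1, by omega, fun i hi => ?_⟩
      congr 1; omega
    set p := Nat.find hex with hp
    obtain ⟨hpn, hpc⟩ := Nat.find_spec hex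
    rw [← hp] at hpn hpc
    have hr := hrun p (n - p) _ hpc
    rcases Nat.eq_zero_or_pos p with h0 | hp0
    · rw [h0] at hr
      simp only [zero_add, Nat.sub_zero] at hr
      refine hr.trans (mul_le_mul_of_nonneg_right ?_ (Real.exp_pos _).le)
      calc C ≤ D * C := le_mul_of_one_le_left (by linarith) hD
        _ ≤ _ := le_self_pow₀ hDC (by omega)
    · have hsw : switchCount c p + 1 ≤ switchCount c n := by
        obtain ⟨q, hq⟩ : ∃ q, p = q + 1 := ⟨p - 1, by omega⟩
        rw [hq]
        refine switchCount_lt_of_ne (by omega) fun heq => ?_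
        refine Nat.find_min hex (m := q) (by omega) ⟨by omega, fun i hi => ?_⟩
        rcases Nat.eq_zero_or_pos i with rfl | hi0
        · rw [add_zero, heq]
          have := hpc 0 (by omega)
          rwa [add_zero, hq] at this
        · have := hpc (i - 1) (by omega)
          rwa [hq, show q + 1 + (i - 1) = q + i by omega] at this
      have e : n = p + (n - p) := by omega
      have hsplit : ∑ i ∈ Finset.range n, β (c i) =
          ∑ i ∈ Finset.range p, β (c i) + ∑ i ∈ Finset.range (n - p), β (c (p + i)) := by
        conv_lhs => rw [e]
        rw [Finset.sum_range_add]
      rw [hsplit, Real.exp_add]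
      calc a c n = a c (p + (n - p)) := by rw [← e]
        _ ≤ D * a c p * a (fun i => c (p + i)) (n - p) := hmul _ _ _
        _ ≤ D * ((D * C) ^ (switchCount c p + 1) * Real.exp (∑ i ∈ Finset.range p, β (c i))) *
            (C * Real.exp (∑ i ∈ Finset.range (n - p), β (c (p + i)))) := by
          refine mul_le_mul (mul_le_mul_of_nonneg_left (ih p hpn) (by linarith)) hr (ha _ _) ?_
          positivity
        _ = (D * C) ^ (switchCount c p + 1 + 1) * (Real.exp (∑ i ∈ Finset.range p, β (c i)) *
            Real.exp (∑ i ∈ Finset.range (n - p), β (c (p + i)))) := by ring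
        _ ≤ _ := by
          refine mul_le_mul_of_nonneg_right (pow_le_pow_right₀ hDC (by omega)) (by positivity)

theorem SwitchesRarely.eventually_le {c : ℕ → Fin k} (h : SwitchesRarely c) {ε : ℝ} (hε : 0 < ε) :
    ∀ᶠ n : ℕ in atTop, (switchCount c n : ℝ) ≤ ε * n := by
  filter_upwards [h.def hε] with n hn
  simpa using hn

theorem FrequenciesCondition.frequently_lt {c : ℕ → Fin k} (h : FrequenciesCondition c)
    (j : Fin k) {ε : ℝ} (hε : 0 < ε) :
    ∃ᶠ n : ℕ in atTop, (1 - ε) * n ≤ (((Finset.range n).filter fun m => c m = j).card : ℝ) := by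
  have hnn : ∀ n, 0 ≤ freq c n j := fun n => by unfold freq; positivity
  have hlt : 1 - ε < limsup (fun n => freq c n j) atTop := by rw [h j]; linarith
  have hf : ∃ᶠ n in atTop, 1 - ε < freq c n j :=
    frequently_lt_of_lt_limsup
      (IsBoundedUnder.isCoboundedUnder_le (isBoundedUnder_of ⟨0, fun n => hnn n⟩)) hlt
  refine (hf.and_eventually (eventually_gt_atTop 0)).mono fun n hn => ?_
  have hn0 : (0 : ℝ) < n := by exact_mod_cast hn.2
  have := hn.1.le
  rwa [freq, le_div_iff₀ hn0] at this

theorem exists_uniform_bound {a : (ℕ → Fin k) → ℕ → ℝ} {β : Fin k → ℝ}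
    (h : ∀ i, ∃ C : ℝ, 1 ≤ C ∧ ∀ m : ℕ, a (fun _ => i) m ≤ C * Real.exp (β i * m)) :
    ∃ C : ℝ, 1 ≤ C ∧ ∀ i (m : ℕ), a (fun _ => i) m ≤ C * Real.exp (β i * m) := by
  choose C hC1 hC using h
  have hs : ∀ i, C i ≤ 1 + ∑ i, C i := fun i => by
    have := Finset.single_le_sum (f := C) (fun i _ => by linarith [hC1 i]) (Finset.mem_univ i)
    linarith
  refine ⟨1 + ∑ i, C i, ?_, fun i m => (hC i m).trans ?_⟩
  · have := Finset.sum_nonneg (s := Finset.univ) (f := C) fun i _ => by linarith [hC1 i]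
    linarith
  · exact mul_le_mul_of_nonneg_right (hs i) (Real.exp_pos _).le

/-- If the functional decays exponentially along all constant words, it is summable along a rarely
switching sequence. -/
theorem summable_of_switchesRarely {a : (ℕ → Fin k) → ℕ → ℝ} (ha : ∀ c n, 0 ≤ a c n)
    (hcongr : ∀ c c' n, (∀ i < n, c i = c' i) → a c n = a c' n) {D : ℝ} (hD : 1 ≤ D)
    (hmul : ∀ c n m, a c (n + m) ≤ D * a c n * a (fun i => c (n + i)) m)
    (hdec : ∀ i, ∃ C b : ℝ, 1 ≤ C ∧ 0 < b ∧ ∀ m : ℕ, a (fun _ => i) m ≤ C * Real.exp (-b * m))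
    {c : ℕ → Fin k} (hc : SwitchesRarely c) : Summable (a c) := by
  choose C₀ b hC₀ hb hdec using hdec
  obtain ⟨C, hC, hβ⟩ := exists_uniform_bound (a := a) (β := fun i => -b i)
    fun i => ⟨C₀ i, hC₀ i, hdec i⟩
  have hDC : 1 ≤ D * C := one_le_mul_of_one_le_of_one_le hD hC
  have : Nonempty (Fin k) := ⟨c 0⟩
  obtain ⟨j, hj⟩ := Finite.exists_min b
  set κ := Real.log (D * C) with hκ
  have hκ0 : 0 ≤ κ := Real.log_nonneg hDC
  have hbj := hb j
  -- With this switch density the runs cost at most `exp (b j / 2 * n)`, half of the slowest decay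
  -- `b j`. The `+ 1` covers the case `κ = 0`.
  have hε : 0 < b j / (2 * (κ + 1)) := by positivity
  have hgeom : Summable fun n : ℕ => (D * C) * Real.exp (-(b j / 2)) ^ n :=
    (summable_geometric_of_lt_one (Real.exp_pos _).le
      (by rw [Real.exp_lt_one_iff]; linarith)).mul_left _
  refine hgeom.of_norm_bounded_eventually_nat ?_
  filter_upwards [hc.eventually_le hε] with n hn
  rw [Real.norm_of_nonneg (ha _ _)]
  refine (le_pow_switchCount_mul_exp ha hcongr hD hC hmul hβ c n).trans ?_
  rw [pow_succ', mul_assoc]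
  refine mul_le_mul_of_nonneg_left ?_ (by linarith)
  rw [← Real.rpow_natCast, Real.rpow_def_of_pos (by linarith), ← Real.exp_add, ← Real.exp_nat_mul]
  refine Real.exp_le_exp.2 ?_
  have h1 : ∑ i ∈ Finset.range n, -b (c i) ≤ ∑ i ∈ Finset.range n, -b j :=
    Finset.sum_le_sum fun i _ => neg_le_neg (hj _)
  rw [Finset.sum_const, Finset.card_range, nsmul_eq_mul] at h1
  have h2 : κ * switchCount c n ≤ κ * (b j / (2 * (κ + 1)) * n) :=
    mul_le_mul_of_nonneg_left hn hκ0
  have h3 : κ * (b j / (2 * (κ + 1)) * n) ≤ b j / 2 * n := by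
    have : κ * (b j / (2 * (κ + 1))) ≤ b j / 2 := by
      rw [← mul_div_assoc, div_le_div_iff₀ (by positivity) two_pos]
      nlinarith
    nlinarith [(Nat.cast_nonneg n : (0 : ℝ) ≤ n)]
  rw [← hκ]
  linarith

/-- If the functional decays exponentially along the constant word `j`, and grows at most
exponentially along the others, it is small infinitely often along a rarely switching sequence in
which `j` has upper frequency `1`. -/
theorem frequently_lt_of_switchesRarely {a : (ℕ → Fin k) → ℕ → ℝ} (ha : ∀ c n, 0 ≤ a c n)
    (hcongr : ∀ c c' n, (∀ i < n, c i = c' i) → a c n = a c' n) {D : ℝ} (hD : 1 ≤ D)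
    (hmul : ∀ c n m, a c (n + m) ≤ D * a c n * a (fun i => c (n + i)) m) {κ₀ : ℝ} (hκ₀ : 0 ≤ κ₀)
    (hgrow : ∀ i (m : ℕ), a (fun _ => i) m ≤ Real.exp (κ₀ * m)) {j : Fin k}
    (hdec : ∃ C b : ℝ, 1 ≤ C ∧ 0 < b ∧ ∀ m : ℕ, a (fun _ => j) m ≤ C * Real.exp (-b * m))
    {c : ℕ → Fin k} (hc : SwitchesRarely c) (hf : FrequenciesCondition c) {η : ℝ} (hη : 0 < η) :
    ∃ᶠ n in atTop, a c n < η := by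
  classical
  obtain ⟨C, b, hC, hb, hdec⟩ := hdec
  -- The rate is `-b` for the label `j` and `κ₀` for the others, written with an indicator so that
  -- summing it counts occurrences of `j`.
  have hβ : ∀ i (m : ℕ), a (fun _ => i) m ≤
      C * Real.exp ((κ₀ - (b + κ₀) * if i = j then 1 else 0) * m) := by
    intro i m
    split_ifs with h
    · subst h
      refine (hdec m).trans (le_of_eq ?_)
      ring_nf
    · rw [mul_zero, sub_zero]
      exact (hgrow i m).trans (le_mul_of_one_le_left (Real.exp_pos _).le hC)
  have hDC : 1 ≤ D * C := one_le_mul_of_one_le_of_one_le hD hC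
  set κ := Real.log (D * C) with hκ
  have hκ0 : 0 ≤ κ := Real.log_nonneg hDC
  -- This `ε` bounds both the switch density and the share of labels other than `j`: the exponent is
  -- at most `(-b + ε * (κ + b + κ₀)) * n = -(b / 2) * n`.
  set ε := b / (2 * (κ + b + κ₀)) with hε_def
  have hε : 0 < ε := by positivity
  have hlim : Tendsto (fun n : ℕ => (D * C) * Real.exp (-(b / 2)) ^ n) atTop (𝓝 ((D * C) * 0)) :=
    (tendsto_pow_atTop_nhds_zero_of_lt_one (Real.exp_pos _).le
      (by rw [Real.exp_lt_one_iff]; linarith)).const_mul _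
  rw [mul_zero] at hlim
  refine ((hf.frequently_lt j hε).and_eventually
    ((hc.eventually_le hε).and (hlim.eventually_lt_const hη))).mono ?_
  rintro n ⟨h1, h2, h3⟩
  refine lt_of_le_of_lt ?_ h3
  refine (le_pow_switchCount_mul_exp ha hcongr hD hC hmul hβ c n).trans ?_
  rw [pow_succ', mul_assoc]
  refine mul_le_mul_of_nonneg_left ?_ (by linarith)
  rw [← Real.rpow_natCast, Real.rpow_def_of_pos (by linarith), ← Real.exp_add, ← Real.exp_nat_mul]
  refine Real.exp_le_exp.2 ?_
  rw [Finset.sum_sub_distrib, ← Finset.mul_sum, Finset.sum_boole, Finset.sum_const,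
    Finset.card_range, nsmul_eq_mul, ← hκ]
  have h4 : κ * switchCount c n ≤ κ * (ε * n) := mul_le_mul_of_nonneg_left h2 hκ0
  have h5 := mul_le_mul_of_nonneg_left h1 (by linarith : 0 ≤ b + κ₀)
  have h6 : ε * (κ + b + κ₀) = b / 2 := by
    rw [hε_def]; field_simp
  have h7 : ε * (κ + b + κ₀) * n = b / 2 * n := by rw [h6]
  linarith

end Runs

/-! ### Separated systems of contractions: compositions, ratios, separation -/

/-- A finite family of contractions `map e` of `[l, u]`, each carrying a label in `ι`, such that
all compositions have bounded distortion and the images of different maps with the same label are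
a definite distance apart. -/
structure SeparatedIFS (E ι : Type*) (l u : ℝ) where
  lt : l < u
  lab : E → ι
  lab_surjective : Function.Surjective lab
  map : E → ℝ → ℝ
  mapsTo : ∀ e, MapsTo (map e) (Icc l u) (Icc l u)
  /-- the contraction ratio -/
  θ : ℝ
  θ_pos : 0 < θ
  θ_lt_one : θ < 1
  map_le : ∀ e, ∀ x ∈ Icc l u, ∀ y ∈ Icc l u, |map e x - map e y| ≤ θ * |x - y|
  /-- the lower Lipschitz constant -/
  ρ : ℝ
  ρ_pos : 0 < ρ
  le_map : ∀ e, ∀ x ∈ Icc l u, ∀ y ∈ Icc l u, ρ * |x - y| ≤ |map e x - map e y|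
  /-- the distortion constant -/
  D : ℝ
  one_le_D : 1 ≤ D
  distortion : ∀ w : List E, ∀ x ∈ Icc l u, ∀ y ∈ Icc l u, ∀ x' ∈ Icc l u, ∀ y' ∈ Icc l u,
    |w.foldr map x - w.foldr map y| * |x' - y'| ≤
      D * (|x - y| * |w.foldr map x' - w.foldr map y'|)
  /-- the gap between images with the same label -/
  g : ℝ
  g_pos : 0 < g
  gap : ∀ e e', e ≠ e' → lab e = lab e' → ∀ x ∈ Icc l u, ∀ y ∈ Icc l u, g ≤ |map e x - map e' y|

namespace List

theorem exists_eq_append_cons_of_map_eq {α β : Type*} {f : α → β} {w w' : List α}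
    (h : w.map f = w'.map f) (hne : w ≠ w') :
    ∃ v e e' a b, w = v ++ e :: a ∧ w' = v ++ e' :: b ∧ e ≠ e' ∧ f e = f e' := by
  induction w generalizing w' with
  | nil => cases w' <;> simp_all
  | cons e w ih =>
    cases w' with
    | nil => simp at h
    | cons e' w' =>
      simp only [List.map_cons, List.cons.injEq] at h
      by_cases he : e = e'
      · subst he
        obtain ⟨v, e₁, e₂, a, b, h₁, h₂, h₃⟩ := ih h.2 fun h' => hne (by rw [h'])
        exact ⟨e :: v, e₁, e₂, a, b, by simp [h₁], by simp [h₂], h₃⟩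
      · exact ⟨[], e, e', w, w', rfl, rfl, he, h.1⟩

end List

namespace SeparatedIFS

variable {E ι : Type*} {l u : ℝ} (S : SeparatedIFS E ι l u)

/-- The composition of the maps along a word. -/
def comp (w : List E) (x : ℝ) : ℝ := w.foldr S.map x

/-- The size of the image of `[l, u]` under the composition along a word. -/
noncomputable def ratio (w : List E) : ℝ := |S.comp w u - S.comp w l| / (u - l)

theorem D_pos : 0 < S.D := zero_lt_one.trans_le S.one_le_D

theorem sub_pos (S : SeparatedIFS E ι l u) : 0 < u - l := _root_.sub_pos.2 S.lt

theorem left_mem (S : SeparatedIFS E ι l u) : l ∈ Icc l u := left_mem_Icc.2 S.lt.le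

theorem right_mem (S : SeparatedIFS E ι l u) : u ∈ Icc l u := right_mem_Icc.2 S.lt.le

theorem comp_append (v w : List E) (x : ℝ) : S.comp (v ++ w) x = S.comp v (S.comp w x) :=
  List.foldr_append

theorem comp_cons (e : E) (w : List E) (x : ℝ) : S.comp (e :: w) x = S.map e (S.comp w x) := rfl

theorem comp_mem (w : List E) {x : ℝ} (hx : x ∈ Icc l u) : S.comp w x ∈ Icc l u := by
  induction w with
  | nil => exact hx
  | cons e w ih => exact S.mapsTo e ih

theorem comp_le_pow (w : List E) {x y : ℝ} (hx : x ∈ Icc l u) (hy : y ∈ Icc l u) :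
    |S.comp w x - S.comp w y| ≤ S.θ ^ w.length * |x - y| := by
  induction w with
  | nil => simp [comp]
  | cons e w ih =>
    rw [comp_cons, comp_cons, List.length_cons, pow_succ', mul_assoc]
    exact (S.map_le e _ (S.comp_mem w hx) _ (S.comp_mem w hy)).trans
      (mul_le_mul_of_nonneg_left ih S.θ_pos.le)

theorem pow_le_comp (w : List E) {x y : ℝ} (hx : x ∈ Icc l u) (hy : y ∈ Icc l u) :
    S.ρ ^ w.length * |x - y| ≤ |S.comp w x - S.comp w y| := by
  induction w with
  | nil => simp [comp]
  | cons e w ih =>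
    rw [comp_cons, comp_cons, List.length_cons, pow_succ', mul_assoc]
    exact (mul_le_mul_of_nonneg_left ih S.ρ_pos.le).trans
      (S.le_map e _ (S.comp_mem w hx) _ (S.comp_mem w hy))

theorem ratio_le_pow (w : List E) : S.ratio w ≤ S.θ ^ w.length := by
  have h := S.comp_le_pow w S.right_mem S.left_mem
  rwa [abs_of_pos S.sub_pos, ← div_le_iff₀ S.sub_pos] at h

theorem pow_le_ratio (w : List E) : S.ρ ^ w.length ≤ S.ratio w := by
  have h := S.pow_le_comp w S.right_mem S.left_mem
  rwa [abs_of_pos S.sub_pos, ← le_div_iff₀ S.sub_pos] at h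

theorem ratio_pos (w : List E) : 0 < S.ratio w :=
  (pow_pos S.ρ_pos _).trans_le (S.pow_le_ratio w)

theorem ratio_le_one (w : List E) : S.ratio w ≤ 1 :=
  (S.ratio_le_pow w).trans (pow_le_one₀ S.θ_pos.le S.θ_lt_one.le)

theorem ratio_mul_sub (w : List E) : S.ratio w * (u - l) = |S.comp w u - S.comp w l| :=
  div_mul_cancel₀ _ S.sub_pos.ne'

/-- Bounded distortion tested against the endpoints, whose images define `ratio`; `le_comp` puts the
endpoints on the other side. -/
theorem comp_le (w : List E) {x y : ℝ} (hx : x ∈ Icc l u) (hy : y ∈ Icc l u) :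
    |S.comp w x - S.comp w y| ≤ S.D * S.ratio w * |x - y| := by
  have h := S.distortion w x hx y hy u S.right_mem l S.left_mem
  change |S.comp w x - S.comp w y| * |u - l| ≤ S.D * (|x - y| * |S.comp w u - S.comp w l|) at h
  rw [abs_of_pos S.sub_pos, ← ratio_mul_sub] at h
  refine le_of_mul_le_mul_right (h.trans_eq ?_) S.sub_pos
  ring

theorem le_comp (w : List E) {x y : ℝ} (hx : x ∈ Icc l u) (hy : y ∈ Icc l u) :
    S.ratio w * |x - y| ≤ S.D * |S.comp w x - S.comp w y| := by
  have h := S.distortion w u S.right_mem l S.left_mem x hx y hy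
  change |S.comp w u - S.comp w l| * |x - y| ≤ S.D * (|u - l| * |S.comp w x - S.comp w y|) at h
  rw [abs_of_pos S.sub_pos, ← ratio_mul_sub] at h
  refine le_of_mul_le_mul_right ((le_of_eq ?_).trans (h.trans_eq ?_)) S.sub_pos <;> ring

theorem ratio_append_le (v w : List E) : S.ratio (v ++ w) ≤ S.D * (S.ratio v * S.ratio w) := by
  refine le_of_mul_le_mul_right ?_ S.sub_pos
  rw [ratio_mul_sub, comp_append, comp_append]
  refine (S.comp_le v (S.comp_mem w S.right_mem) (S.comp_mem w S.left_mem)).trans_eq ?_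
  rw [← ratio_mul_sub]
  ring

theorem le_ratio_append (v w : List E) : S.ratio v * S.ratio w ≤ S.D * S.ratio (v ++ w) := by
  refine le_of_mul_le_mul_right ?_ S.sub_pos
  rw [mul_assoc S.D, ratio_mul_sub, comp_append, comp_append, mul_assoc, ratio_mul_sub]
  exact S.le_comp v (S.comp_mem w S.right_mem) (S.comp_mem w S.left_mem)

theorem ratio_append_le_left (v w : List E) : S.ratio (v ++ w) ≤ S.D * S.ratio v :=
  (S.ratio_append_le v w).trans (mul_le_mul_of_nonneg_left
    (mul_le_of_le_one_right (S.ratio_pos v).le (S.ratio_le_one w)) S.D_pos.le)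

theorem image_append_subset (v w : List E) :
    S.comp (v ++ w) '' Icc l u ⊆ S.comp v '' Icc l u := by
  rintro _ ⟨x, hx, rfl⟩
  exact ⟨S.comp w x, S.comp_mem w hx, (S.comp_append v w x).symm⟩

theorem image_take_subset (w : List E) (m : ℕ) :
    S.comp w '' Icc l u ⊆ S.comp (w.take m) '' Icc l u := by
  conv_lhs => rw [← List.take_append_drop m w]
  exact S.image_append_subset _ _

/-- Points with different codes of the same labels are apart, in terms of the common prefix of
their codes. -/
theorem exists_common_prefix {w w' : List E} (h : w.map S.lab = w'.map S.lab) (hne : w ≠ w')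
    {x y : ℝ} (hx : x ∈ S.comp w '' Icc l u) (hy : y ∈ S.comp w' '' Icc l u) :
    ∃ p < w.length, w.take p = w'.take p ∧ S.ratio (w.take p) * S.g ≤ S.D * |x - y| := by
  obtain ⟨v, e, e', a, b, rfl, rfl, hee, hlab⟩ := List.exists_eq_append_cons_of_map_eq h hne
  obtain ⟨x, hx, rfl⟩ := hx
  obtain ⟨y, hy, rfl⟩ := hy
  refine ⟨v.length, by simp, by simp, ?_⟩
  rw [List.take_left, comp_append, comp_append, comp_cons, comp_cons]
  have ha := S.comp_mem a hx
  have hb := S.comp_mem b hy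
  exact (mul_le_mul_of_nonneg_left (S.gap e e' hee hlab _ ha _ hb) (S.ratio_pos v).le).trans
    (S.le_comp v (S.mapsTo e ha) (S.mapsTo e' hb))

/-! ### Words, partition sums and critical exponents -/

section Words

variable [Fintype E]

open Classical in
/-- The words of length `n` whose labels are `c 0, …, c (n - 1)`. -/
noncomputable def words (c : ℕ → ι) (n : ℕ) : Finset (List E) :=
  ((Finset.univ : Finset (Fin n → E)).image List.ofFn).filter
    fun w => w.map S.lab = (List.range n).map c

theorem mem_words {c : ℕ → ι} {n : ℕ} {w : List E} :
    w ∈ S.words c n ↔ w.map S.lab = (List.range n).map c := by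
  classical
  simp only [words, Finset.mem_filter, Finset.mem_image, Finset.mem_univ, true_and,
    and_iff_right_iff_imp]
  intro h
  obtain rfl : w.length = n := by simpa using congrArg List.length h
  exact ⟨w.get, List.ofFn_get w⟩

theorem length_of_mem_words {c : ℕ → ι} {n : ℕ} {w : List E} (h : w ∈ S.words c n) :
    w.length = n := by
  simpa using congrArg List.length (S.mem_words.1 h)

theorem card_words_le (c : ℕ → ι) (n : ℕ) : (S.words c n).card ≤ Fintype.card E ^ n := by
  classical
  rw [words]
  refine (Finset.card_filter_le _ _).trans (Finset.card_image_le.trans ?_)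
  simp

theorem words_nonempty (c : ℕ → ι) (n : ℕ) : (S.words c n).Nonempty := by
  choose e he using S.lab_surjective
  refine ⟨(List.range n).map fun i => e (c i), S.mem_words.2 ?_⟩
  simp [Function.comp_def, he]

theorem words_congr {c c' : ℕ → ι} {n : ℕ} (h : ∀ i < n, c i = c' i) :
    S.words c n = S.words c' n := by
  ext w
  rw [mem_words, mem_words, List.map_congr_left fun i hi => h i (List.mem_range.1 hi)]

theorem range_add_map (c : ℕ → ι) (n m : ℕ) : (List.range (n + m)).map c =
    (List.range n).map c ++ (List.range m).map fun i => c (n + i) := by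
  simp [List.range_add, Function.comp_def]

theorem append_mem_words {c : ℕ → ι} {n m : ℕ} {v w : List E} (hv : v ∈ S.words c n)
    (hw : w ∈ S.words (fun i => c (n + i)) m) : v ++ w ∈ S.words c (n + m) := by
  rw [mem_words] at *
  rw [List.map_append, hv, hw, range_add_map]

theorem take_drop_mem_words {c : ℕ → ι} {n m : ℕ} {w : List E} (hw : w ∈ S.words c (n + m)) :
    w.take n ∈ S.words c n ∧ w.drop n ∈ S.words (fun i => c (n + i)) m := by
  rw [mem_words, range_add_map] at hw
  rw [mem_words, mem_words, List.map_take, List.map_drop, hw]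
  exact ⟨List.take_left' (by simp), List.drop_left' (by simp)⟩

theorem take_mem_words {c : ℕ → ι} {n m : ℕ} (hmn : m ≤ n) {w : List E} (hw : w ∈ S.words c n) :
    w.take m ∈ S.words c m := by
  obtain ⟨p, rfl⟩ := Nat.exists_eq_add_of_le hmn
  exact (S.take_drop_mem_words hw).1

theorem sum_words_add (c : ℕ → ι) (n m : ℕ) (f : List E → ℝ) :
    ∑ w ∈ S.words c (n + m), f w =
      ∑ v ∈ S.words c n, ∑ w ∈ S.words (fun i => c (n + i)) m, f (v ++ w) := by
  rw [← Finset.sum_product']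
  refine Finset.sum_nbij' (fun w => (w.take n, w.drop n)) (fun p => p.1 ++ p.2) ?_ ?_ ?_ ?_ ?_
  · intro w hw
    exact Finset.mem_product.2 (S.take_drop_mem_words hw)
  · intro p hp
    exact S.append_mem_words (Finset.mem_product.1 hp).1 (Finset.mem_product.1 hp).2
  · intro w _
    exact List.take_append_drop n w
  · intro p hp
    have h := S.length_of_mem_words (Finset.mem_product.1 hp).1
    exact Prod.ext (List.take_left' h) (List.drop_left' h)
  · intro w _
    rw [List.take_append_drop]

/-- The partition sum `∑ |I_w| ^ s` over the words of length `n`. -/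
noncomputable def Z (s : ℝ) (c : ℕ → ι) (n : ℕ) : ℝ := ∑ w ∈ S.words c n, S.ratio w ^ s

theorem Z_pos (s : ℝ) (c : ℕ → ι) (n : ℕ) : 0 < S.Z s c n :=
  Finset.sum_pos (fun w _ => Real.rpow_pos_of_pos (S.ratio_pos w) s) (S.words_nonempty c n)

theorem Z_congr (s : ℝ) (c c' : ℕ → ι) (n : ℕ) (h : ∀ i < n, c i = c' i) :
    S.Z s c n = S.Z s c' n := by
  rw [Z, Z, S.words_congr h]

variable {s : ℝ}

theorem Z_add_le (hs : 0 ≤ s) (c : ℕ → ι) (n m : ℕ) :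
    S.Z s c (n + m) ≤ S.D ^ s * S.Z s c n * S.Z s (fun i => c (n + i)) m := by
  rw [Z, sum_words_add, mul_assoc, Z, Z, Finset.sum_mul_sum, Finset.mul_sum]
  refine Finset.sum_le_sum fun v _ => ?_
  rw [Finset.mul_sum]
  refine Finset.sum_le_sum fun w _ => ?_
  have hv := (S.ratio_pos v).le
  have hw := (S.ratio_pos w).le
  rw [← Real.mul_rpow hv hw, ← Real.mul_rpow S.D_pos.le (mul_nonneg hv hw)]
  exact Real.rpow_le_rpow (S.ratio_pos _).le (S.ratio_append_le v w) hs

theorem Z_mul_le (hs : 0 ≤ s) (c : ℕ → ι) (n m : ℕ) :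
    S.Z s c n * S.Z s (fun i => c (n + i)) m ≤ S.D ^ s * S.Z s c (n + m) := by
  rw [Z, Z, Z, sum_words_add, Finset.sum_mul_sum, Finset.mul_sum]
  refine Finset.sum_le_sum fun v _ => ?_
  rw [Finset.mul_sum]
  refine Finset.sum_le_sum fun w _ => ?_
  rw [← Real.mul_rpow (S.ratio_pos v).le (S.ratio_pos w).le,
    ← Real.mul_rpow S.D_pos.le (S.ratio_pos _).le]
  exact Real.rpow_le_rpow (mul_nonneg (S.ratio_pos v).le (S.ratio_pos w).le)
    (S.le_ratio_append v w) hs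

/-- With this, `Z⁻¹` is submultiplicative with the same constant as `Z`, so lower bounds for `Z`
follow from the lemmas on runs as well. -/
theorem inv_Z_add_le (hs : 0 ≤ s) (c : ℕ → ι) (n m : ℕ) :
    (S.Z s c (n + m))⁻¹ ≤ S.D ^ s * (S.Z s c n)⁻¹ * (S.Z s (fun i => c (n + i)) m)⁻¹ := by
  have h1 := S.Z_pos s c n
  have h2 := S.Z_pos s (fun i => c (n + i)) m
  have h3 := S.Z_pos s c (n + m)
  rw [mul_assoc, ← mul_inv, ← div_eq_mul_inv, le_div_iff₀ (mul_pos h1 h2), inv_mul_le_iff₀ h3,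
    mul_comm (S.Z s c (n + m))]
  exact S.Z_mul_le hs c n m

theorem Z_le_pow (hs : 0 ≤ s) (c : ℕ → ι) (n : ℕ) : S.Z s c n ≤ (Fintype.card E : ℝ) ^ n := by
  have h := Finset.sum_le_card_nsmul (S.words c n) (fun w => S.ratio w ^ s) 1
    fun w _ => Real.rpow_le_one (S.ratio_pos w).le (S.ratio_le_one w) hs
  rw [nsmul_eq_mul, mul_one] at h
  exact h.trans (by exact_mod_cast S.card_words_le c n)

theorem pow_le_Z (hs : 0 ≤ s) (c : ℕ → ι) (n : ℕ) : (S.ρ ^ s) ^ n ≤ S.Z s c n := by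
  obtain ⟨w, hw⟩ := S.words_nonempty c n
  calc (S.ρ ^ s) ^ n = (S.ρ ^ n) ^ s := by
        rw [← Real.rpow_natCast, ← Real.rpow_natCast, ← Real.rpow_mul S.ρ_pos.le,
          ← Real.rpow_mul S.ρ_pos.le, mul_comm]
    _ ≤ S.ratio w ^ s := by
        have h := S.pow_le_ratio w
        rw [S.length_of_mem_words hw] at h
        exact Real.rpow_le_rpow (pow_pos S.ρ_pos n).le h hs
    _ ≤ S.Z s c n := Finset.single_le_sum (f := fun w => S.ratio w ^ s)
        (fun w _ => Real.rpow_nonneg (S.ratio_pos w).le s) hw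

/-- Every word of length `n` has ratio at most `θ ^ n`. This exponential gain in the exponent makes
the transition at `critExp` sharp. -/
theorem Z_le_pow_mul_Z {t : ℝ} (hst : s ≤ t) (c : ℕ → ι) (n : ℕ) :
    S.Z t c n ≤ (S.θ ^ (t - s)) ^ n * S.Z s c n := by
  rw [Z, Z, Finset.mul_sum]
  refine Finset.sum_le_sum fun w hw => ?_
  have h := S.ratio_le_pow w
  rw [S.length_of_mem_words hw] at h
  have e : (S.θ ^ (t - s)) ^ n = (S.θ ^ n) ^ (t - s) := by
    rw [← Real.rpow_natCast, ← Real.rpow_natCast, ← Real.rpow_mul S.θ_pos.le,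
      ← Real.rpow_mul S.θ_pos.le, mul_comm]
  rw [e, show t = (t - s) + s by ring, Real.rpow_add (S.ratio_pos w), show t - s + s - s = t - s by
    ring]
  exact mul_le_mul_of_nonneg_right (Real.rpow_le_rpow (S.ratio_pos w).le h (by linarith))
    (Real.rpow_nonneg (S.ratio_pos w).le s)

theorem Z_anti {t : ℝ} (hst : s ≤ t) (c : ℕ → ι) (n : ℕ) : S.Z t c n ≤ S.Z s c n := by
  refine (S.Z_le_pow_mul_Z hst c n).trans (mul_le_of_le_one_left (S.Z_pos s c n).le ?_)
  exact pow_le_one₀ (Real.rpow_nonneg S.θ_pos.le _)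
    (Real.rpow_le_one S.θ_pos.le S.θ_lt_one.le (by linarith))

/-- The exponent at which the partition sums of the constant label sequence `i` change from
exponential growth to exponential decay. -/
noncomputable def critExp (i : ι) : ℝ :=
  sInf {s : ℝ | 0 ≤ s ∧ ∃ n : ℕ, 0 < n ∧ S.D ^ s * S.Z s (fun _ => i) n < 1}

theorem critExp_nonneg (i : ι) : 0 ≤ S.critExp i := Real.sInf_nonneg fun _ h => h.1

/-- Needed for the infimum in `critExp` to be meaningful. Fix `n` with `D * θ ^ n < 1`; then `D ^ m
* Z m n ≤ (D * θ ^ n) ^ m * Z 0 n`, which tends to `0` as the exponent `m` grows. -/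
theorem exists_subcritical (i : ι) :
    {s : ℝ | 0 ≤ s ∧ ∃ n : ℕ, 0 < n ∧ S.D ^ s * S.Z s (fun _ => i) n < 1}.Nonempty := by
  have h1 : ∀ᶠ n : ℕ in atTop, S.D * S.θ ^ n < 1 := by
    have := (tendsto_pow_atTop_nhds_zero_of_lt_one S.θ_pos.le S.θ_lt_one).const_mul S.D
    rw [mul_zero] at this
    exact this.eventually_lt_const one_pos
  obtain ⟨n, hn, hn0⟩ := (h1.and (eventually_gt_atTop 0)).exists
  have h0 : 0 < S.D * S.θ ^ n := mul_pos S.D_pos (pow_pos S.θ_pos n)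
  have h2 : Tendsto (fun m : ℕ => (S.D * S.θ ^ n) ^ m * S.Z 0 (fun _ => i) n) atTop (𝓝 0) := by
    simpa using (tendsto_pow_atTop_nhds_zero_of_lt_one h0.le hn).mul_const (S.Z 0 (fun _ => i) n)
  obtain ⟨m, hm⟩ := (h2.eventually_lt_const one_pos).exists
  refine ⟨m, Nat.cast_nonneg m, n, hn0, lt_of_le_of_lt ?_ hm⟩
  have h3 := S.Z_le_pow_mul_Z (Nat.cast_nonneg m : (0 : ℝ) ≤ m) (fun _ => i) n
  rw [sub_zero, Real.rpow_natCast] at h3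
  rw [Real.rpow_natCast, mul_pow, mul_assoc]
  refine mul_le_mul_of_nonneg_left (h3.trans_eq ?_) (pow_pos S.D_pos m).le
  rw [← pow_mul, ← pow_mul, mul_comm n m]

theorem Z_decay_of_critExp_lt {i : ι} (h : S.critExp i < s) :
    ∃ C b : ℝ, 1 ≤ C ∧ 0 < b ∧ ∀ m : ℕ, S.Z s (fun _ => i) m ≤ C * Real.exp (-b * m) := by
  obtain ⟨t, ⟨ht0, n, hn, hlt⟩, hts⟩ := exists_lt_of_csInf_lt (S.exists_subcritical i) h
  obtain ⟨C, b, hC, hb, hdec⟩ := exists_exp_decay_of_submultiplicative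
    (fun n => (S.Z_pos t (fun _ => i) n).le) (fun n m => S.Z_add_le ht0 (fun _ => i) n m) hn hlt
  exact ⟨C, b, hC, hb, fun m => (S.Z_anti hts.le _ m).trans (hdec m)⟩

/-- An exponent `t` between `s` and `critExp i` is not in the defining set, so `D ^ t * Z t n ≥ 1`
for all `n > 0`; lowering `t` to `s` gains `θ ^ (-(t - s) * n)`. -/
theorem inv_Z_decay_of_lt_critExp {i : ι} (hs : 0 ≤ s) (h : s < S.critExp i) :
    ∃ C b : ℝ, 1 ≤ C ∧ 0 < b ∧ ∀ m : ℕ, (S.Z s (fun _ => i) m)⁻¹ ≤ C * Real.exp (-b * m) := by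
  obtain ⟨t, hst, ht⟩ := exists_between h
  have hnot : ∀ n : ℕ, 0 < n → 1 ≤ S.D ^ t * S.Z t (fun _ => i) n := by
    intro n hn
    by_contra! hlt
    exact notMem_of_lt_csInf ht ⟨0, fun _ hx => hx.1⟩ ⟨by linarith, n, hn, hlt⟩
  have hDt : 1 ≤ S.D ^ t := Real.one_le_rpow S.one_le_D (by linarith)
  refine ⟨S.D ^ t, -Real.log S.θ * (t - s), hDt, mul_pos (neg_pos.2
    (Real.log_neg S.θ_pos S.θ_lt_one)) (by linarith), fun m => ?_⟩
  have hexp : Real.exp (-(-Real.log S.θ * (t - s)) * m) = (S.θ ^ (t - s)) ^ m := by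
    rw [Real.rpow_def_of_pos S.θ_pos, ← Real.exp_nat_mul]
    ring_nf
  rw [hexp, inv_le_iff_one_le_mul₀ (S.Z_pos _ _ _)]
  -- The definition of `critExp` says nothing about length `0`; there the empty word gives `Z = 1`.
  rcases Nat.eq_zero_or_pos m with rfl | hm
  · have h0 : S.Z s (fun _ => i) 0 = 1 := by
      have : S.words (fun _ => i) 0 = {[]} := by
        ext w
        simp [mem_words]
      rw [Z, this, Finset.sum_singleton, ratio, comp, comp, List.foldr_nil, List.foldr_nil,
        abs_of_pos S.sub_pos, div_self S.sub_pos.ne', Real.one_rpow]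
    simpa [h0] using hDt
  · refine (hnot m hm).trans ?_
    rw [mul_assoc]
    exact mul_le_mul_of_nonneg_left (S.Z_le_pow_mul_Z hst.le _ m) (by linarith)

end Words

end SeparatedIFS

/-! ### The limit set and its Hausdorff dimension -/

namespace SeparatedIFS

variable {E ι : Type*} {l u : ℝ} (S : SeparatedIFS E ι l u)

theorem continuousOn_comp (w : List E) : ContinuousOn (S.comp w) (Icc l u) := by
  have h : LipschitzOnWith (S.θ.toNNReal ^ w.length) (S.comp w) (Icc l u) := by
    refine LipschitzOnWith.of_dist_le_mul fun x hx y hy => ?_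
    rw [Real.dist_eq, Real.dist_eq, NNReal.coe_pow, Real.coe_toNNReal _ S.θ_pos.le]
    exact S.comp_le_pow w hx hy
  exact h.continuousOn

theorem isCompact_image_comp (w : List E) : IsCompact (S.comp w '' Icc l u) :=
  isCompact_Icc.image_of_continuousOn (S.continuousOn_comp w)

theorem abs_sub_le_of_mem_image {w : List E} {x y : ℝ} (hx : x ∈ S.comp w '' Icc l u)
    (hy : y ∈ S.comp w '' Icc l u) : |x - y| ≤ S.D * (u - l) * S.ratio w := by
  obtain ⟨x, hx, rfl⟩ := hx
  obtain ⟨y, hy, rfl⟩ := hy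
  have h : |x - y| ≤ u - l := abs_sub_le_iff.2 ⟨by linarith [hx.2, hy.1], by linarith [hy.2, hx.1]⟩
  calc _ ≤ S.D * S.ratio w * |x - y| := S.comp_le w hx hy
    _ ≤ S.D * S.ratio w * (u - l) :=
      mul_le_mul_of_nonneg_left h (mul_nonneg S.D_pos.le (S.ratio_pos w).le)
    _ = _ := by ring

theorem ediam_image_le (w : List E) :
    Metric.ediam (S.comp w '' Icc l u) ≤ ENNReal.ofReal (S.D * (u - l) * S.ratio w) := by
  refine Metric.ediam_le fun x hx y hy => ?_
  rw [edist_dist, Real.dist_eq]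
  exact ENNReal.ofReal_le_ofReal (S.abs_sub_le_of_mem_image hx hy)

variable [Fintype E]

/-- The limit set of the compositions along the label sequence `c`. -/
def limitSet (c : ℕ → ι) : Set ℝ :=
  {x | ∀ n, ∃ w ∈ S.words c n, x ∈ S.comp w '' Icc l u}

theorem isCompact_biUnion_image (c : ℕ → ι) (n : ℕ) :
    IsCompact (⋃ w ∈ S.words c n, S.comp w '' Icc l u) :=
  (S.words c n).isCompact_biUnion fun w _ => S.isCompact_image_comp w

theorem limitSet_eq_iInter (c : ℕ → ι) :
    S.limitSet c = ⋂ n, ⋃ w ∈ S.words c n, S.comp w '' Icc l u := by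
  ext x
  simp only [limitSet, mem_ofPred_eq, mem_iInter, mem_iUnion, exists_prop]

theorem isCompact_limitSet (c : ℕ → ι) : IsCompact (S.limitSet c) := by
  rw [limitSet_eq_iInter]
  exact (S.isCompact_biUnion_image c 0).of_isClosed_subset
    (isClosed_iInter fun n => (S.isCompact_biUnion_image c n).isClosed) (iInter_subset _ 0)

theorem limitSet_nonempty (c : ℕ → ι) : (S.limitSet c).Nonempty := by
  rw [limitSet_eq_iInter]
  refine IsCompact.nonempty_iInter_of_sequence_nonempty_isCompact_isClosed _ ?_ ?_
    (S.isCompact_biUnion_image c 0) fun n => (S.isCompact_biUnion_image c n).isClosed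
  · intro n x hx
    simp only [mem_iUnion, exists_prop] at hx ⊢
    obtain ⟨w, hw, hxw⟩ := hx
    exact ⟨w.take n, S.take_mem_words n.le_succ hw, S.image_take_subset w n hxw⟩
  · intro n
    obtain ⟨w, hw⟩ := S.words_nonempty c n
    exact ⟨S.comp w l, mem_biUnion hw ⟨l, S.left_mem, rfl⟩⟩

theorem comp_mem_limitSet {c : ℕ → ι} {n : ℕ} {w : List E} (hw : w ∈ S.words c n) {y : ℝ}
    (hy : y ∈ S.limitSet fun i => c (n + i)) : S.comp w y ∈ S.limitSet c := by
  intro m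
  rcases le_total m n with hmn | hmn
  · refine ⟨w.take m, S.take_mem_words hmn hw, S.image_take_subset w m ⟨y, ?_, rfl⟩⟩
    obtain ⟨v, _, x, hx, rfl⟩ := hy 0
    exact S.comp_mem v hx
  · obtain ⟨p, rfl⟩ := Nat.exists_eq_add_of_le hmn
    obtain ⟨v, hv, x, hx, rfl⟩ := hy p
    exact ⟨w ++ v, S.append_mem_words hw hv, x, hx, S.comp_append w v x⟩

theorem exists_mem_limitSet_of_mem_words {c : ℕ → ι} {n : ℕ} {w : List E}
    (hw : w ∈ S.words c n) : ∃ x ∈ S.limitSet c, x ∈ S.comp w '' Icc l u := by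
  obtain ⟨y, hy⟩ := S.limitSet_nonempty fun i => c (n + i)
  refine ⟨_, S.comp_mem_limitSet hw hy, y, ?_, rfl⟩
  obtain ⟨v, _, x, hx, rfl⟩ := hy 0
  exact S.comp_mem v hx

variable {s : ℝ}

/-- At the levels with `Z < 1` the cylinders form covers of mesh tending to `0` whose `s`-sums are
at most `L ^ s`, so `μH[s]` is finite. -/
theorem dimH_limitSet_le (hs : 0 ≤ s) {c : ℕ → ι} (h : ∃ᶠ n in atTop, S.Z s c n < 1) :
    dimH (S.limitSet c) ≤ ENNReal.ofReal s := by
  obtain ⟨m, hm, hZ⟩ := exists_seq_forall_of_frequently h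
  set L := S.D * (u - l) with hL
  have hL0 : 0 < L := mul_pos S.D_pos S.sub_pos
  have hle := Measure.hausdorffMeasure_le_liminf_sum (X := ℝ) (ι := fun n => S.words c (m n))
    (l := atTop) s (S.limitSet c) (fun n => ENNReal.ofReal (L * S.θ ^ m n)) (by
      have h1 := ((tendsto_pow_atTop_nhds_zero_of_lt_one S.θ_pos.le S.θ_lt_one).comp hm).const_mul L
      rw [mul_zero] at h1
      have h2 := ENNReal.tendsto_ofReal h1
      rwa [ENNReal.ofReal_zero] at h2)
    (fun n w => S.comp w.1 '' Icc l u)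
    (Eventually.of_forall fun n w => (S.ediam_image_le w.1).trans (ENNReal.ofReal_le_ofReal (by
      have := S.ratio_le_pow w.1
      rw [S.length_of_mem_words w.2] at this
      exact mul_le_mul_of_nonneg_left this hL0.le)))
    (Eventually.of_forall fun n x hx => by
      obtain ⟨w, hw, hxw⟩ := hx (m n)
      exact mem_iUnion.2 ⟨⟨w, hw⟩, hxw⟩)
  have hbound : ∀ n, ∑ w : S.words c (m n), Metric.ediam (S.comp w.1 '' Icc l u) ^ s ≤
      ENNReal.ofReal (L ^ s) := by
    intro n
    calc ∑ w : S.words c (m n), Metric.ediam (S.comp w.1 '' Icc l u) ^ s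
        ≤ ∑ w : S.words c (m n), ENNReal.ofReal (L ^ s * S.ratio w.1 ^ s) := by
          refine Finset.sum_le_sum fun w _ => ?_
          rw [← Real.mul_rpow hL0.le (S.ratio_pos _).le,
            ← ENNReal.ofReal_rpow_of_nonneg (mul_nonneg hL0.le (S.ratio_pos _).le) hs]
          exact ENNReal.rpow_le_rpow (S.ediam_image_le w.1) hs
      _ = ENNReal.ofReal (L ^ s * S.Z s c (m n)) := by
          rw [← ENNReal.ofReal_sum_of_nonneg fun w _ => mul_nonneg (Real.rpow_nonneg hL0.le s)
            (Real.rpow_nonneg (S.ratio_pos _).le s), Z, Finset.mul_sum,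
            Finset.sum_coe_sort (S.words c (m n)) fun w => L ^ s * S.ratio w ^ s]
      _ ≤ _ := ENNReal.ofReal_le_ofReal
          (mul_le_of_le_one_right (Real.rpow_nonneg hL0.le s) (hZ n).le)
  have hfin : μH[s] (S.limitSet c) ≠ ⊤ := by
    refine ne_top_of_le_ne_top ENNReal.ofReal_ne_top (b := ENNReal.ofReal (L ^ s)) (hle.trans ?_)
    refine (liminf_le_liminf (Eventually.of_forall hbound)).trans ?_
    rw [liminf_const]
  have := dimH_le_of_hausdorffMeasure_ne_top (d := s.toNNReal) (s := S.limitSet c)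
    (by rwa [Real.coe_toNNReal _ hs])
  exact this

/-- The partition sum over those words whose marked points lie in a set of diameter `δ` is at most
a multiple of `δ ^ s`. -/
theorem sum_ratio_rpow_le (hs : 0 ≤ s) {c : ℕ → ι} {c₀ : ℝ} (hc₀ : 0 < c₀)
    (hZ : ∀ n, c₀ ≤ S.Z s c n) {N : ℕ} {x : List E → ℝ}
    (hx : ∀ w ∈ S.words c N, x w ∈ S.comp w '' Icc l u) {δ : ℝ} (hδ : 0 < δ)
    (hN : S.θ ^ N * S.g ≤ S.D * δ) {T : Finset (List E)} (hT : T ⊆ S.words c N)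
    (hdiam : ∀ w ∈ T, ∀ w' ∈ T, |x w - x w'| ≤ δ) :
    ∑ w ∈ T, S.ratio w ^ s ≤ (S.D * S.D * (S.D / S.g)) ^ s / c₀ * δ ^ s * S.Z s c N := by
  classical
  rcases T.eq_empty_or_nonempty with rfl | ⟨w₀, hw₀⟩
  · have hD := S.D_pos
    have hg := S.g_pos
    have hZ0 := S.Z_pos s c N
    rw [Finset.sum_empty]
    positivity
  have hw₀N := hT hw₀
  have hlen₀ := S.length_of_mem_words hw₀N
  have hex : ∃ m, m ≤ N ∧ S.ratio (w₀.take m) * S.g ≤ S.D * δ := by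
    refine ⟨N, le_rfl, le_trans (mul_le_mul_of_nonneg_right ?_ S.g_pos.le) hN⟩
    have := S.ratio_le_pow (w₀.take N)
    rwa [List.length_take, hlen₀, min_self] at this
  -- The first level at which the cylinder of `w₀` is too small for its gaps to exceed `δ`. At every
  -- earlier level a disagreement would push the marked points further apart, so all words of `T`
  -- share the prefix of length `m`.
  set m := Nat.find hex with hm
  obtain ⟨hmN, hmr⟩ := Nat.find_spec hex
  rw [← hm] at hmN hmr
  have hpre : ∀ w ∈ T, w.take m = w₀.take m := by
    intro w hw
    by_contra hne
    have hwm := S.take_mem_words hmN (hT hw)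
    have hw₀m := S.take_mem_words hmN hw₀N
    obtain ⟨p, hp, heq, hle⟩ := S.exists_common_prefix (w := w₀.take m) (w' := w.take m)
      ((S.mem_words.1 hw₀m).trans (S.mem_words.1 hwm).symm) (Ne.symm hne)
      (S.image_take_subset _ m (hx _ hw₀N)) (S.image_take_subset _ m (hx _ (hT hw)))
    rw [S.length_of_mem_words hw₀m] at hp
    rw [List.take_take, min_eq_left hp.le] at hle
    exact Nat.find_min hex hp ⟨by omega, hle.trans
      (mul_le_mul_of_nonneg_left (hdiam _ hw₀ _ hw) S.D_pos.le)⟩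
  clear_value m
  obtain ⟨q, rfl⟩ := Nat.exists_eq_add_of_le hmN
  set v := w₀.take m with hv
  set c' := fun i => c (m + i) with hc'
  have hsub : T ⊆ (S.words c' q).image fun w => v ++ w := by
    intro w hw
    refine Finset.mem_image.2 ⟨w.drop m, (S.take_drop_mem_words (hT hw)).2, ?_⟩
    rw [← hpre w hw, List.take_append_drop]
  have hr : S.ratio v ≤ S.D / S.g * δ := by
    rw [div_mul_eq_mul_div, le_div_iff₀ S.g_pos]
    exact hmr
  have hZm := S.Z_pos s c m
  -- The lower bound `c₀ ≤ Z s c m` enters here: it bounds the partition sum of the tails by that of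
  -- the whole words.
  have hZ' : S.Z s c' q ≤ S.D ^ s * S.Z s c (m + q) / c₀ := by
    rw [le_div_iff₀ hc₀]
    calc S.Z s c' q * c₀ ≤ S.Z s c' q * S.Z s c m :=
          mul_le_mul_of_nonneg_left (hZ m) (S.Z_pos s c' q).le
      _ = S.Z s c m * S.Z s c' q := mul_comm _ _
      _ ≤ _ := S.Z_mul_le hs c m q
  calc ∑ w ∈ T, S.ratio w ^ s ≤ ∑ w ∈ (S.words c' q).image fun w => v ++ w, S.ratio w ^ s :=
        Finset.sum_le_sum_of_subset_of_nonneg hsub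
          fun w _ _ => Real.rpow_nonneg (S.ratio_pos w).le s
    _ = ∑ w ∈ S.words c' q, S.ratio (v ++ w) ^ s :=
        Finset.sum_image fun a _ b _ h => List.append_cancel_left h
    _ ≤ ∑ w ∈ S.words c' q, (S.D * S.ratio v) ^ s * S.ratio w ^ s := by
        refine Finset.sum_le_sum fun w _ => ?_
        rw [← Real.mul_rpow (mul_nonneg S.D_pos.le (S.ratio_pos v).le) (S.ratio_pos w).le, mul_assoc]
        exact Real.rpow_le_rpow (S.ratio_pos _).le (S.ratio_append_le v w) hs
    _ = (S.D * S.ratio v) ^ s * S.Z s c' q := by rw [Z, Finset.mul_sum]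
    _ ≤ (S.D * (S.D / S.g * δ)) ^ s * (S.D ^ s * S.Z s c (m + q) / c₀) := by
        refine mul_le_mul (Real.rpow_le_rpow (mul_nonneg S.D_pos.le (S.ratio_pos v).le)
          (mul_le_mul_of_nonneg_left hr S.D_pos.le) hs) hZ' (S.Z_pos s c' q).le ?_
        have hD := S.D_pos
        have hg := S.g_pos
        positivity
    _ = _ := by
        have hD := S.D_pos
        have hg := S.g_pos
        have hDg : 0 < S.D / S.g := by positivity
        rw [Real.mul_rpow hD.le (by positivity), Real.mul_rpow hDg.le hδ.le,
          Real.mul_rpow (by positivity : 0 ≤ S.D * S.D) hDg.le, Real.mul_rpow hD.le hD.le]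
        ring

/-- Mass distribution principle: at a level `N` fine enough for all of the finitely many `U i`, give
the marked point of `w` the mass `ratio w ^ s / Z s c N`. The total is `1`, and `U i` carries at
most a constant times `δ i ^ s`. -/
theorem le_sum_of_cover (hs : 0 ≤ s) {c : ℕ → ι} {c₀ : ℝ} (hc₀ : 0 < c₀)
    (hZ : ∀ n, c₀ ≤ S.Z s c n) {κ : Type*} (J : Finset κ) (U : κ → Set ℝ) (δ : κ → ℝ)
    (hδ : ∀ i ∈ J, 0 < δ i) (hdiam : ∀ i ∈ J, ∀ x ∈ U i, ∀ y ∈ U i, |x - y| ≤ δ i)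
    (hcov : S.limitSet c ⊆ ⋃ i ∈ J, U i) :
    1 ≤ (S.D * S.D * (S.D / S.g)) ^ s / c₀ * ∑ i ∈ J, δ i ^ s := by
  classical
  have hlim : Tendsto (fun N : ℕ => S.θ ^ N * S.g) atTop (𝓝 0) := by
    simpa using (tendsto_pow_atTop_nhds_zero_of_lt_one S.θ_pos.le S.θ_lt_one).mul_const S.g
  have hN : ∀ᶠ N : ℕ in atTop, ∀ i ∈ J, S.θ ^ N * S.g ≤ S.D * δ i :=
    (Finset.eventually_all J).2 fun i hi =>
      (hlim.eventually_lt_const (mul_pos S.D_pos (hδ i hi))).mono fun _ h => h.le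
  obtain ⟨N, hN⟩ := hN.exists
  have hpt : ∀ w : List E, ∃ x, w ∈ S.words c N → x ∈ S.limitSet c ∧ x ∈ S.comp w '' Icc l u := by
    intro w
    by_cases hw : w ∈ S.words c N
    · obtain ⟨x, hx⟩ := S.exists_mem_limitSet_of_mem_words hw
      exact ⟨x, fun _ => hx⟩
    · exact ⟨0, fun h => absurd h hw⟩
  choose x hx using hpt
  have hZN := S.Z_pos s c N
  set K := (S.D * S.D * (S.D / S.g)) ^ s / c₀ with hK
  have hnn : ∀ w, 0 ≤ S.ratio w ^ s := fun w => Real.rpow_nonneg (S.ratio_pos w).le s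
  have key : S.Z s c N ≤ ∑ i ∈ J, K * δ i ^ s * S.Z s c N := by
    calc S.Z s c N ≤ ∑ w ∈ S.words c N, ∑ i ∈ J, if x w ∈ U i then S.ratio w ^ s else 0 := by
          refine Finset.sum_le_sum fun w hw => ?_
          obtain ⟨i, hi, hxi⟩ := mem_iUnion₂.1 (hcov (hx w hw).1)
          refine le_trans ?_ (Finset.single_le_sum (fun i _ => ?_) hi)
          · rw [if_pos hxi]
          · split_ifs
            exacts [hnn w, le_rfl]
      _ = ∑ i ∈ J, ∑ w ∈ (S.words c N).filter fun w => x w ∈ U i, S.ratio w ^ s := by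
          rw [Finset.sum_comm]
          exact Finset.sum_congr rfl fun i _ => (Finset.sum_filter _ _).symm
      _ ≤ _ := by
          refine Finset.sum_le_sum fun i hi => ?_
          refine S.sum_ratio_rpow_le hs hc₀ hZ (x := x) (fun w hw => (hx w hw).2) (hδ i hi)
            (hN i hi) (Finset.filter_subset _ _) fun w hw w' hw' => ?_
          exact hdiam i hi _ (Finset.mem_filter.1 hw).2 _ (Finset.mem_filter.1 hw').2
  rw [← Finset.sum_mul, ← Finset.mul_sum] at key
  exact le_of_mul_le_mul_right (by rwa [one_mul]) hZN

/-- If `μH[s]` vanished, some countable cover would have `s`-sum below `1 / (4 * K)`. Fattening it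
to an open cover at most doubles this bound, and a finite subcover, which exists by compactness,
contradicts `le_sum_of_cover`. -/
theorem le_dimH_limitSet (hs : 0 < s) {c : ℕ → ι} {c₀ : ℝ} (hc₀ : 0 < c₀)
    (hZ : ∀ n, c₀ ≤ S.Z s c n) : ENNReal.ofReal s ≤ dimH (S.limitSet c) := by
  suffices h : μH[s] (S.limitSet c) ≠ 0 by
    exact le_dimH_of_hausdorffMeasure_ne_zero (d := s.toNNReal)
      (by rwa [Real.coe_toNNReal _ hs.le])
  set K := (S.D * S.D * (S.D / S.g)) ^ s / c₀ with hK
  have hK0 : 0 < K := by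
    have hD := S.D_pos
    have hg := S.g_pos
    positivity
  intro hzero
  rw [Measure.hausdorffMeasure_apply] at hzero
  have h1 := (iSup₂_eq_bot.1 (hzero.trans bot_eq_zero.symm)) 1 one_pos
  set ε := ENNReal.ofReal (1 / (4 * K)) with hε
  have hε0 : 0 < ε := ENNReal.ofReal_pos.2 (by positivity)
  have h2 : ⨅ (t : ℕ → Set ℝ) (_ : S.limitSet c ⊆ ⋃ n, t n) (_ : ∀ n, Metric.ediam (t n) ≤ 1),
      ∑' n, ⨆ _ : (t n).Nonempty, Metric.ediam (t n) ^ s < ε := by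
    rw [h1]; exact hε0
  simp only [iInf_lt_iff] at h2
  obtain ⟨t, hcov, hdiam, hsum⟩ := h2
  have hfin : ∀ n, Metric.ediam (t n) ≠ ⊤ := fun n =>
    ne_top_of_le_ne_top ENNReal.one_ne_top (hdiam n)
  set d : ℕ → ℝ := fun n => (Metric.ediam (t n)).toReal with hd
  have hd0 : ∀ n, 0 ≤ d n := fun n => ENNReal.toReal_nonneg
  -- Continuity of `x ^ s` for `s > 0` also covers sets of diameter `0`; the allowed increases form
  -- a geometric series.
  have hslack : ∀ n : ℕ, ∃ η > 0, (d n + 2 * η) ^ s < d n ^ s + 1 / (4 * K) * (1 / 2) ^ (n + 1) := by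
    intro n
    have hc : ContinuousAt (fun η : ℝ => (d n + 2 * η) ^ s) 0 :=
      ContinuousAt.rpow_const (by fun_prop) (Or.inr hs.le)
    have hlt : (fun η : ℝ => (d n + 2 * η) ^ s) 0 < d n ^ s + 1 / (4 * K) * (1 / 2) ^ (n + 1) := by
      simp only [mul_zero, add_zero]
      have : 0 < 1 / (4 * K) * (1 / 2 : ℝ) ^ (n + 1) := by positivity
      linarith
    have hev := hc.eventually_lt_const hlt
    have hev' := (hev.filter_mono (nhdsWithin_le_nhds (s := Ioi 0))).and self_mem_nhdsWithin
    obtain ⟨η, h, hη⟩ := hev'.exists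
    exact ⟨η, hη, h⟩
  choose η hη hηs using hslack
  obtain ⟨J, hJ⟩ := (S.isCompact_limitSet c).elim_finite_subcover
    (fun n => Metric.thickening (η n) (t n)) (fun n => Metric.isOpen_thickening)
    (hcov.trans (iUnion_mono fun n => Metric.self_subset_thickening (hη n) _))
  classical
  -- The Hausdorff sum counts only nonempty sets, and an empty set has empty thickening.
  set J' := J.filter fun n => (t n).Nonempty with hJ'
  have hcov' : S.limitSet c ⊆ ⋃ n ∈ J', Metric.thickening (η n) (t n) := by
    intro x hx
    obtain ⟨n, hn, hxn⟩ := mem_iUnion₂.1 (hJ hx)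
    refine mem_iUnion₂.2 ⟨n, Finset.mem_filter.2 ⟨hn, ?_⟩, hxn⟩
    obtain ⟨y, hy, _⟩ := Metric.mem_thickening_iff.1 hxn
    exact ⟨y, hy⟩
  have hmass := S.le_sum_of_cover hs.le hc₀ hZ J' (fun n => Metric.thickening (η n) (t n))
    (fun n => d n + 2 * η n) (fun n _ => by linarith [hd0 n, hη n]) (by
      intro n _ x hx y hy
      obtain ⟨x', hx', hxx⟩ := Metric.mem_thickening_iff.1 hx
      obtain ⟨y', hy', hyy⟩ := Metric.mem_thickening_iff.1 hy
      have h3 : dist x' y' ≤ d n := by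
        rw [dist_edist]
        exact ENNReal.toReal_mono (hfin n) (Metric.edist_le_ediam_of_mem hx' hy')
      rw [dist_comm] at hyy
      have := dist_triangle4 x x' y' y
      rw [← Real.dist_eq]
      linarith) hcov'
  have hsum' : ∑ n ∈ J', d n ^ s ≤ 1 / (4 * K) := by
    rw [← ENNReal.ofReal_le_ofReal_iff (by positivity),
      ENNReal.ofReal_sum_of_nonneg fun n _ => Real.rpow_nonneg (hd0 n) s]
    calc ∑ n ∈ J', ENNReal.ofReal (d n ^ s)
        = ∑ n ∈ J', ⨆ _ : (t n).Nonempty, Metric.ediam (t n) ^ s := by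
          refine Finset.sum_congr rfl fun n hn => ?_
          rw [iSup_pos (Finset.mem_filter.1 hn).2, ← ENNReal.ofReal_rpow_of_nonneg (hd0 n) hs.le,
            ENNReal.ofReal_toReal (hfin n)]
      _ ≤ ∑' n, ⨆ _ : (t n).Nonempty, Metric.ediam (t n) ^ s := ENNReal.sum_le_tsum _
      _ ≤ _ := hsum.le
  have hgeo : ∑ n ∈ J', (1 / 2 : ℝ) ^ (n + 1) ≤ 1 := by
    have h4 : HasSum (fun n : ℕ => (1 / 2 : ℝ) ^ (n + 1)) 1 := by
      have := hasSum_geometric_two' 1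
      simpa [pow_succ, div_eq_mul_inv, mul_comm] using this
    exact sum_le_hasSum _ (fun n _ => by positivity) h4
  have htotal : ∑ n ∈ J', (d n + 2 * η n) ^ s ≤ 1 / (4 * K) + 1 / (4 * K) * 1 := by
    calc ∑ n ∈ J', (d n + 2 * η n) ^ s
        ≤ ∑ n ∈ J', (d n ^ s + 1 / (4 * K) * (1 / 2) ^ (n + 1)) :=
          Finset.sum_le_sum fun n _ => (hηs n).le
      _ = ∑ n ∈ J', d n ^ s + 1 / (4 * K) * ∑ n ∈ J', (1 / 2 : ℝ) ^ (n + 1) := by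
          rw [Finset.sum_add_distrib, Finset.mul_sum]
      _ ≤ _ := add_le_add hsum' (mul_le_mul_of_nonneg_left hgeo (by positivity))
  have h5 := hmass.trans (mul_le_mul_of_nonneg_left htotal hK0.le)
  have h6 : K * (1 / (4 * K) + 1 / (4 * K) * 1) = 1 / 2 := by
    field_simp
    norm_num
  rw [h6] at h5
  norm_num at h5

end SeparatedIFS

/-! ### The upper box dimension of the limit set -/

namespace SeparatedIFS

variable {E ι : Type*} {l u : ℝ} (S : SeparatedIFS E ι l u) [Fintype E] {s : ℝ}

/-- Every point of the limit set has a code whose ratio is comparable to `t`. -/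
theorem exists_code_of_size {c : ℕ → ι} {t : ℝ} (ht1 : t < 1) {N : ℕ}
    (hN : S.θ ^ N ≤ t) {x : ℝ} (hx : x ∈ S.limitSet c) :
    ∃ n ≤ N, ∃ w ∈ S.words c n, x ∈ S.comp w '' Icc l u ∧ S.ratio w ≤ t ∧
      S.ρ * t ≤ S.D * S.ratio w := by
  classical
  obtain ⟨w, hw, hxw⟩ := hx N
  have hlen := S.length_of_mem_words hw
  have hex : ∃ m, m ≤ N ∧ S.ratio (w.take m) ≤ t := by
    refine ⟨N, le_rfl, le_trans ?_ hN⟩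
    have := S.ratio_le_pow (w.take N)
    rwa [List.length_take, hlen, min_self] at this
  obtain ⟨hmN, hmr⟩ := Nat.find_spec hex
  have hmin := fun q => Nat.find_min hex (m := q)
  generalize Nat.find hex = m at hmN hmr hmin
  refine ⟨m, hmN, w.take m, S.take_mem_words hmN hw, S.image_take_subset w m hxw, hmr, ?_⟩
  rcases Nat.eq_zero_or_pos m with rfl | hm
  · rw [List.take_zero] at hmr
    have h := S.pow_le_ratio []
    rw [List.length_nil, pow_zero] at h
    linarith
  · obtain ⟨q, rfl⟩ : ∃ q, m = q + 1 := ⟨m - 1, by omega⟩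
    -- The prefix one letter shorter is still larger than `t`, and one letter loses at most the
    -- factor `ρ / D`.
    have hq : t < S.ratio (w.take q) := by
      by_contra! h
      exact hmin q (by omega) ⟨by omega, h⟩
    have hqlt : q < w.length := by omega
    have hρ := S.pow_le_ratio [w[q]]
    rw [List.length_singleton, pow_one] at hρ
    rw [List.take_succ_eq_append_getElem hqlt]
    refine le_trans ?_ (S.le_ratio_append _ _)
    rw [mul_comm]
    exact mul_le_mul hq.le hρ S.ρ_pos.le (S.ratio_pos _).le

/-- Cutting each code when its cylinder reaches diameter about `δ` gives a cover by cylinders of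
varying lengths, each contributing at least a multiple of `δ ^ s` to `∑ Z s c n`. The varying
lengths are why summability is required. -/
theorem upperBoxDim_limitSet_le (hs : 0 ≤ s) {c : ℕ → ι} (h : Summable (S.Z s c)) :
    upperBoxDim (S.limitSet c) ≤ ENNReal.ofReal s := by
  classical
  have hD := S.D_pos
  have hρ := S.ρ_pos
  have hL0 := S.sub_pos
  set L := S.D * (u - l) with hL
  have hLpos : 0 < L := mul_pos hD hL0
  set M := ∑' n, S.Z s c n with hM
  refine upperBoxDim_le_of_eventually (C := M * (S.ρ / S.D / L) ^ (-s)) hs ?_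
  filter_upwards [eventually_lt_nhdsGT_zero (r := L.toNNReal) (by simpa using hLpos)] with δ hδ
  have hδ0 : (0 : ℝ) < δ := hδ.1
  have hδL : (δ : ℝ) < L := by
    have := hδ.2
    rwa [Real.lt_toNNReal_iff_coe_lt] at this
  set t : ℝ := δ / L with ht
  have ht0 : 0 < t := div_pos hδ0 hLpos
  have ht1 : t < 1 := (div_lt_one hLpos).2 hδL
  obtain ⟨N, hN⟩ := exists_pow_lt_of_lt_one ht0 S.θ_lt_one
  set T : Finset (List E) := (Finset.range (N + 1)).biUnion fun n =>
    (S.words c n).filter fun w => S.ρ * t ≤ S.D * S.ratio w ∧ S.ratio w ≤ t with hT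
  have hcover : Metric.IsCover δ (S.limitSet c) ((fun w => S.comp w l) '' (T : Set (List E))) := by
    intro x hx
    obtain ⟨n, hn, w, hw, hxw, hr, hr'⟩ := S.exists_code_of_size ht1 hN.le hx
    refine ⟨S.comp w l, ⟨w, ?_, rfl⟩, ?_⟩
    · exact Finset.mem_coe.2 (Finset.mem_biUnion.2 ⟨n, Finset.mem_range.2 (by omega),
        Finset.mem_filter.2 ⟨hw, hr', hr⟩⟩)
    · have h1 := S.abs_sub_le_of_mem_image hxw (mem_image_of_mem _ S.left_mem)
      have h2 : |x - S.comp w l| ≤ δ := by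
        refine h1.trans ((mul_le_mul_of_nonneg_left hr hLpos.le).trans_eq ?_)
        rw [ht, mul_div_cancel₀ _ hLpos.ne']
      change edist x (S.comp w l) ≤ δ
      rw [edist_dist, Real.dist_eq, ← ENNReal.ofReal_coe_nnreal]
      exact ENNReal.ofReal_le_ofReal h2
  have hcard : (T.card : ℝ) * (S.ρ / S.D * t) ^ s ≤ M := by
    calc (T.card : ℝ) * (S.ρ / S.D * t) ^ s
        ≤ (∑ n ∈ Finset.range (N + 1), (((S.words c n).filter fun w =>
            S.ρ * t ≤ S.D * S.ratio w ∧ S.ratio w ≤ t).card : ℝ)) * (S.ρ / S.D * t) ^ s := by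
          refine mul_le_mul_of_nonneg_right ?_ (by positivity)
          exact_mod_cast Finset.card_biUnion_le
      _ ≤ ∑ n ∈ Finset.range (N + 1), S.Z s c n := by
          rw [Finset.sum_mul]
          refine Finset.sum_le_sum fun n _ => ?_
          rw [← nsmul_eq_mul]
          refine (Finset.card_nsmul_le_sum _ (fun w => S.ratio w ^ s) _ fun w hw => ?_).trans
            (Finset.sum_le_sum_of_subset_of_nonneg (Finset.filter_subset _ _)
              fun w _ _ => Real.rpow_nonneg (S.ratio_pos w).le s)
          refine Real.rpow_le_rpow (by positivity) ?_ hs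
          rw [div_mul_eq_mul_div, div_le_iff₀ hD, mul_comm _ S.D]
          exact (Finset.mem_filter.1 hw).2.1
      _ ≤ M := h.sum_le_tsum _ fun n _ => (S.Z_pos s c n).le
  have hcard' : (T.card : ℝ) ≤ M * (S.ρ / S.D / L) ^ (-s) * (δ : ℝ) ^ (-s) := by
    have e : S.ρ / S.D * t = S.ρ / S.D / L * δ := by rw [ht]; ring
    rw [e] at hcard
    rw [mul_assoc, ← Real.mul_rpow (by positivity) hδ0.le, Real.rpow_neg (by positivity),
      ← div_eq_mul_inv, le_div_iff₀ (by positivity)]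
    exact hcard
  calc (Metric.externalCoveringNumber δ (S.limitSet c) : ℝ≥0∞)
      ≤ ((T.card : ℕ∞) : ℝ≥0∞) := by
        refine ENat.toENNReal_le.2 (hcover.externalCoveringNumber_le_encard.trans ?_)
        exact (encard_image_le _ _).trans (by rw [encard_coe_eq_coe_finsetCard])
    _ = ENNReal.ofReal (T.card : ℝ) := by
        rw [ENNReal.ofReal_natCast, ENat.toENNReal_coe]
    _ ≤ _ := ENNReal.ofReal_le_ofReal hcard'

open Classical in
-- Two words served by the same ball have limit points within `2 * δ`. Yet their common prefix has
-- ratio at least `t / D`, so the gap keeps these points at least `t * g / D ^ 2` apart; each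
-- comparison costs one `D`.
theorem card_filter_le_externalCoveringNumber {c : ℕ → ι} {n : ℕ} {t : ℝ} {δ : ℝ≥0}
    (hδ : 2 * δ * (S.D * S.D) < t * S.g) :
    (((S.words c n).filter fun w => t ≤ S.ratio w).card : ℕ∞) ≤
      Metric.externalCoveringNumber δ (S.limitSet c) := by
  obtain ⟨C, hC, hCe⟩ := exists_isCover_encard_eq_externalCoveringNumber δ (S.limitSet c)
  rw [← hCe, ← encard_coe_eq_coe_finsetCard]
  have hpt : ∀ w : List E, ∃ y, w ∈ S.words c n →
      y ∈ C ∧ ∃ x ∈ S.comp w '' Icc l u, |x - y| ≤ δ := by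
    intro w
    by_cases hw : w ∈ S.words c n
    · obtain ⟨x, hx, hxw⟩ := S.exists_mem_limitSet_of_mem_words hw
      obtain ⟨y, hy, hxy⟩ := hC hx
      refine ⟨y, fun _ => ⟨hy, x, hxw, ?_⟩⟩
      change edist x y ≤ δ at hxy
      rw [edist_dist, ← ENNReal.ofReal_coe_nnreal, ENNReal.ofReal_le_ofReal_iff (NNReal.coe_nonneg δ)] at hxy
      rwa [← Real.dist_eq]
    · exact ⟨0, fun h => absurd h hw⟩
  choose y hy using hpt
  refine encard_le_encard_of_injOn (f := y) (fun w hw => ?_) ?_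
  · exact (hy w (Finset.mem_filter.1 (Finset.mem_coe.1 hw)).1).1
  · intro w hw w' hw' heq
    obtain ⟨hw, hwt⟩ := Finset.mem_filter.1 (Finset.mem_coe.1 hw)
    obtain ⟨hw', -⟩ := Finset.mem_filter.1 (Finset.mem_coe.1 hw')
    obtain ⟨-, x, hx, hxy⟩ := hy w hw
    obtain ⟨-, x', hx', hxy'⟩ := hy w' hw'
    by_contra hne
    obtain ⟨p, hp, heq', hle⟩ := S.exists_common_prefix
      ((S.mem_words.1 hw).trans (S.mem_words.1 hw').symm) hne hx hx'
    have h1 := S.ratio_append_le_left (w.take p) (w.drop p)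
    rw [List.take_append_drop] at h1
    have h2 : |x - x'| ≤ 2 * δ := by
      rw [← heq] at hxy'
      have := abs_sub_le x (y w) x'
      rw [abs_sub_comm (y w) x'] at this
      linarith
    have h3 : t * S.g ≤ S.D * (S.D * |x - x'|) :=
      calc t * S.g ≤ S.D * S.ratio (w.take p) * S.g :=
            mul_le_mul_of_nonneg_right (hwt.trans h1) S.g_pos.le
        _ = S.D * (S.ratio (w.take p) * S.g) := mul_assoc _ _ _
        _ ≤ _ := mul_le_mul_of_nonneg_left hle S.D_pos.le
    have h4 : S.D * (S.D * |x - x'|) ≤ S.D * (S.D * (2 * δ)) :=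
      mul_le_mul_of_nonneg_left (mul_le_mul_of_nonneg_left h2 S.D_pos.le) S.D_pos.le
    linarith

/-- Dyadic decomposition turning `Z` into counts of words of ratio above a threshold; the one term
with `2 ^ (-(k + 1)) < r ≤ 2 ^ (-k)` suffices. -/
theorem rpow_le_sum_dyadic (hs : 0 ≤ s) {r : ℝ} (h1 : r ≤ 1) {K : ℕ} (hK : (1 / 2 : ℝ) ^ K < r) :
    r ^ s ≤ ∑ k ∈ Finset.range K, if (1 / 2 : ℝ) ^ (k + 1) ≤ r then ((1 / 2 : ℝ) ^ k) ^ s else 0 := by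
  have hr : 0 < r := lt_trans (by positivity) hK
  obtain ⟨k, hk1, hk2⟩ := exists_nat_pow_near_of_lt_one hr h1 (y := (1 / 2 : ℝ)) (by norm_num)
    (by norm_num)
  have hkK : k < K := by
    by_contra! h
    have : (1 / 2 : ℝ) ^ k ≤ (1 / 2) ^ K := pow_le_pow_of_le_one (by norm_num) (by norm_num) h
    linarith
  refine le_trans ?_ (Finset.single_le_sum (fun i _ => ?_) (Finset.mem_range.2 hkK))
  · rw [if_pos hk1.le]
    exact Real.rpow_le_rpow hr.le hk2 hs
  · split_ifs
    · positivity
    · exact le_rfl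

/-- If the dimension were below `r < s`, there would be at most `(κ * t) ^ (-r)` words of ratio at
least `t`. Summing over dyadic `t` bounds `Z s c n` by a geometric series independent of `n`. -/
theorem le_upperBoxDim_limitSet (hs : 0 < s) {c : ℕ → ι}
    (h : ∀ M : ℝ, ∃ᶠ n in atTop, M < S.Z s c n) :
    ENNReal.ofReal s ≤ upperBoxDim (S.limitSet c) := by
  classical
  by_contra! hlt
  obtain ⟨r, hr1, hr2⟩ := ENNReal.lt_iff_exists_nnreal_btwn.1 hlt
  have hD := S.D_pos
  have hg := S.g_pos
  have hrs : (r : ℝ) < s := by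
    rw [← ENNReal.ofReal_coe_nnreal, ENNReal.ofReal_lt_ofReal_iff hs] at hr2
    exact hr2
  have hev := eventually_covering_le_of_upperBoxDim_lt (s := r) r.2 (by simpa using hr1)
  obtain ⟨δ₀, hδ₀, hcov⟩ := (mem_nhdsGT_iff_exists_Ioo_subset).1 hev
  have hδ₀' : (0 : ℝ) < δ₀ := hδ₀
  -- Balls of radius `κ * t` meet the separation condition: `2 * κ * t * D ^ 2 = 2 / 3 * (t * g) < t
  -- * g`.
  set κ := S.g / (3 * (S.D * S.D)) with hκ
  have hκ0 : 0 < κ := by positivity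
  set q := (1 / 2 : ℝ) ^ (s - r) with hq
  have hq0 : 0 ≤ q := by positivity
  have hq1 : q < 1 := Real.rpow_lt_one (by norm_num) (by norm_num) (by linarith)
  have hcount : ∀ t : ℝ, 0 < t → κ * t < δ₀ → ∀ n,
      (((S.words c n).filter fun w => t ≤ S.ratio w).card : ℝ) ≤ (κ * t) ^ (-(r : ℝ)) := by
    intro t ht htδ n
    have hκt : 0 < κ * t := mul_pos hκ0 ht
    have h1 := hcov (a := (κ * t).toNNReal) ⟨Real.toNNReal_pos.2 hκt, by
      rwa [← NNReal.coe_lt_coe, Real.coe_toNNReal _ hκt.le]⟩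
    simp only [mem_ofPred_eq, Real.coe_toNNReal _ hκt.le] at h1
    have h2 := S.card_filter_le_externalCoveringNumber (c := c) (n := n) (t := t)
      (δ := (κ * t).toNNReal) (by
        rw [Real.coe_toNNReal _ hκt.le, hκ]
        have : 2 * (S.g / (3 * (S.D * S.D)) * t) * (S.D * S.D) = 2 / 3 * (t * S.g) := by
          field_simp
        rw [this]
        have := mul_pos ht hg
        linarith)
    have h3 := (ENat.toENNReal_le.2 h2).trans h1
    rw [ENat.toENNReal_coe, ← ENNReal.ofReal_natCast,
      ENNReal.ofReal_le_ofReal_iff (by positivity)] at h3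
    exact h3
  have hθ : ∀ᶠ n : ℕ in atTop, κ * S.θ ^ n < δ₀ := by
    have := (tendsto_pow_atTop_nhds_zero_of_lt_one S.θ_pos.le S.θ_lt_one).const_mul κ
    rw [mul_zero] at this
    exact this.eventually_lt_const hδ₀'
  set M := (κ * (1 / 2)) ^ (-(r : ℝ)) * (1 - q)⁻¹ with hM
  obtain ⟨n, hnM, hnθ⟩ := ((h M).and_eventually hθ).exists
  refine absurd hnM (not_lt.2 ?_)
  have hK : ∃ K : ℕ, (1 / 2 : ℝ) ^ K < S.ρ ^ n :=
    exists_pow_lt_of_lt_one (pow_pos S.ρ_pos n) (by norm_num)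
  obtain ⟨K, hK⟩ := hK
  calc S.Z s c n
      ≤ ∑ w ∈ S.words c n, ∑ k ∈ Finset.range K,
          if (1 / 2 : ℝ) ^ (k + 1) ≤ S.ratio w then ((1 / 2 : ℝ) ^ k) ^ s else 0 := by
        refine Finset.sum_le_sum fun w hw => ?_
        have h1 := S.pow_le_ratio w
        rw [S.length_of_mem_words hw] at h1
        exact rpow_le_sum_dyadic hs.le (S.ratio_le_one w) (hK.trans_le h1)
    _ = ∑ k ∈ Finset.range K,
          (((S.words c n).filter fun w => (1 / 2 : ℝ) ^ (k + 1) ≤ S.ratio w).card : ℝ) *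
            ((1 / 2 : ℝ) ^ k) ^ s := by
        rw [Finset.sum_comm]
        refine Finset.sum_congr rfl fun k _ => ?_
        rw [← Finset.sum_filter, Finset.sum_const, nsmul_eq_mul]
    _ ≤ ∑ k ∈ Finset.range K, (κ * (1 / 2)) ^ (-(r : ℝ)) * q ^ k := by
        refine Finset.sum_le_sum fun k _ => ?_
        have hpow : (κ * (1 / 2) ^ (k + 1)) ^ (-(r : ℝ)) * ((1 / 2 : ℝ) ^ k) ^ s =
            (κ * (1 / 2)) ^ (-(r : ℝ)) * q ^ k := by
          have e1 : κ * (1 / 2 : ℝ) ^ (k + 1) = κ * (1 / 2) * (1 / 2) ^ k := by ring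
          rw [e1, Real.mul_rpow (by positivity) (by positivity), mul_assoc,
            ← Real.rpow_add (by positivity), hq, ← Real.rpow_natCast, ← Real.rpow_natCast,
            ← Real.rpow_mul (by norm_num), ← Real.rpow_mul (by norm_num)]
          ring_nf
        rw [← hpow]
        -- At scales too coarse for the covering bound there is nothing to count, since `n` is so
        -- large that all ratios are below the threshold.
        by_cases hsmall : κ * (1 / 2 : ℝ) ^ (k + 1) < δ₀
        · exact mul_le_mul_of_nonneg_right (hcount _ (by positivity) hsmall n) (by positivity)
        · have hempty : ((S.words c n).filter fun w => (1 / 2 : ℝ) ^ (k + 1) ≤ S.ratio w) = ∅ := by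
            refine Finset.filter_eq_empty_iff.2 fun w hw hle => hsmall ?_
            have h1 := S.ratio_le_pow w
            rw [S.length_of_mem_words hw] at h1
            exact (mul_le_mul_of_nonneg_left (hle.trans h1) hκ0.le).trans_lt hnθ
          rw [hempty, Finset.card_empty, Nat.cast_zero, zero_mul]
          positivity
    _ = (κ * (1 / 2)) ^ (-(r : ℝ)) * ∑ k ∈ Finset.range K, q ^ k := by rw [Finset.mul_sum]
    _ ≤ M := by
        refine mul_le_mul_of_nonneg_left ?_ (by positivity)
        rw [← tsum_geometric_of_lt_one hq0 hq1]
        exact (summable_geometric_of_lt_one hq0 hq1).sum_le_tsum _ fun k _ => by positivity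

end SeparatedIFS

/-! ### Inverse branches of cookie-cutter maps: contraction, distortion, gaps -/

theorem abs_sub_le_of_mem_uIcc {x y x' y' R ξ ξ' : ℝ} (h1 : |x - x'| ≤ R) (h2 : |x - y'| ≤ R)
    (h3 : |y - x'| ≤ R) (h4 : |y - y'| ≤ R) (hξ : ξ ∈ uIcc x y) (hξ' : ξ' ∈ uIcc x' y') :
    |ξ - ξ'| ≤ R := by
  rw [abs_le] at *
  rw [mem_uIcc] at hξ hξ'
  rcases hξ with hξ | hξ <;> rcases hξ' with hξ' | hξ' <;> constructor <;> linarith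

namespace CookieCutterMap

variable {l u : ℝ} (F : CookieCutterMap l u) (i : Fin F.q)

/-- The interval `I_i`. -/
def piece : Set ℝ := Icc (F.left i) (F.right i)

/-- The derivative of the `i`-th branch. -/
noncomputable def branchDeriv (x : ℝ) : ℝ := derivWithin F.toFun (F.piece i) x

/-- The inverse of the `i`-th branch. -/
noncomputable def invBranch : ℝ → ℝ := Function.invFunOn F.toFun (F.piece i)

theorem invBranch_mem {y : ℝ} (hy : y ∈ Icc l u) : F.invBranch i y ∈ F.piece i :=
  Function.invFunOn_mem ((F.bijOn i).surjOn hy)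

theorem toFun_invBranch {y : ℝ} (hy : y ∈ Icc l u) : F.toFun (F.invBranch i y) = y :=
  Function.invFunOn_eq ((F.bijOn i).surjOn hy)

theorem invBranch_toFun {x : ℝ} (hx : x ∈ F.piece i) : F.invBranch i (F.toFun x) = x :=
  (F.bijOn i).injOn (F.invBranch_mem i ((F.bijOn i).mapsTo hx)) hx
    (F.toFun_invBranch i ((F.bijOn i).mapsTo hx))

theorem invBranch_mem_Icc {y : ℝ} (hy : y ∈ Icc l u) : F.invBranch i y ∈ Icc l u :=
  F.subset i (F.invBranch_mem i hy)

/-- The mean value theorem in absolute values, so that the orientation of the branch plays no role.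
-/
theorem exists_abs_sub_eq {x y : ℝ} (hx : x ∈ F.piece i) (hy : y ∈ F.piece i) :
    ∃ ξ ∈ uIcc x y, ξ ∈ F.piece i ∧ |F.toFun x - F.toFun y| = |F.branchDeriv i ξ| * |x - y| := by
  wlog hxy : x ≤ y generalizing x y
  · obtain ⟨ξ, h1, h2, h3⟩ := this hy hx (le_of_not_ge hxy)
    exact ⟨ξ, by rwa [uIcc_comm], h2, by rw [abs_sub_comm, h3, abs_sub_comm y x]⟩
  rcases hxy.eq_or_lt with rfl | hlt
  · exact ⟨x, left_mem_uIcc, hx, by simp⟩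
  have hsub : Icc x y ⊆ F.piece i := Icc_subset_Icc hx.1 hy.2
  have hnhds : ∀ z ∈ Ioo x y, F.piece i ∈ 𝓝 z := fun z hz =>
    mem_of_superset (Ioo_mem_nhds hz.1 hz.2) (Ioo_subset_Icc_self.trans hsub)
  have hdiff : DifferentiableOn ℝ F.toFun (F.piece i) := (F.contDiffOn i).differentiableOn one_ne_zero
  obtain ⟨ξ, hξ, hd⟩ := exists_deriv_eq_slope F.toFun hlt (hdiff.continuousOn.mono hsub)
    fun z hz => ((hdiff z (hsub (Ioo_subset_Icc_self hz))).differentiableAt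
      (hnhds z hz)).differentiableWithinAt
  have hyx : 0 < y - x := sub_pos.2 hlt
  refine ⟨ξ, ?_, hsub (Ioo_subset_Icc_self hξ), ?_⟩
  · rw [uIcc_of_le hxy]
    exact Ioo_subset_Icc_self hξ
  · rw [branchDeriv, derivWithin_of_mem_nhds (hnhds ξ hξ), hd, abs_div, abs_sub_comm x y,
      div_mul_cancel₀ _ (abs_pos.2 hyx.ne').ne', abs_sub_comm]

theorem continuousOn_branchDeriv : ContinuousOn (F.branchDeriv i) (F.piece i) :=
  (F.contDiffOn i).continuousOn_derivWithin (uniqueDiffOn_Icc (F.left_lt_right i)) le_rfl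

theorem exists_one_lt_le_branchDeriv :
    ∃ m : ℝ, 1 < m ∧ ∀ x ∈ F.piece i, m ≤ |F.branchDeriv i x| := by
  obtain ⟨x, hx, hmin⟩ := isCompact_Icc.exists_isMinOn
    (nonempty_Icc.2 (F.left_lt_right i).le) (F.continuousOn_branchDeriv i).abs
  exact ⟨_, F.expanding i x hx, fun y hy => hmin hy⟩

theorem exists_branchDeriv_le : ∃ M : ℝ, 0 < M ∧ ∀ x ∈ F.piece i, |F.branchDeriv i x| ≤ M := by
  obtain ⟨x, hx, hmax⟩ := isCompact_Icc.exists_isMaxOn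
    (nonempty_Icc.2 (F.left_lt_right i).le) (F.continuousOn_branchDeriv i).abs
  exact ⟨_, zero_lt_one.trans (F.expanding i x hx), fun y hy => hmax hy⟩

theorem exists_abs_sub_eq_invBranch {x y : ℝ} (hx : x ∈ Icc l u) (hy : y ∈ Icc l u) :
    ∃ ξ ∈ uIcc (F.invBranch i x) (F.invBranch i y), ξ ∈ F.piece i ∧
      |x - y| = |F.branchDeriv i ξ| * |F.invBranch i x - F.invBranch i y| := by
  obtain ⟨ξ, h1, h2, h3⟩ := F.exists_abs_sub_eq i (F.invBranch_mem i hx) (F.invBranch_mem i hy)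
  rw [F.toFun_invBranch i hx, F.toFun_invBranch i hy] at h3
  exact ⟨ξ, h1, h2, h3⟩

/-- Compactness makes the expansion uniform. The form "for all small `ε`" lets finitely many
branches share one constant. -/
theorem exists_invBranch_contracting : ∀ᶠ ε in 𝓝[>] (0 : ℝ), ∀ x ∈ Icc l u, ∀ y ∈ Icc l u,
    |F.invBranch i x - F.invBranch i y| ≤ (1 - ε) * |x - y| := by
  obtain ⟨m, hm, hle⟩ := F.exists_one_lt_le_branchDeriv i
  have hm0 : 0 < m := zero_lt_one.trans hm
  have hinv : m⁻¹ < 1 := inv_lt_one_of_one_lt₀ hm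
  filter_upwards [Ioo_mem_nhdsGT (sub_pos.2 hinv)] with ε hε x hx y hy
  obtain ⟨ξ, -, hξ, he⟩ := F.exists_abs_sub_eq_invBranch i hx hy
  have h1 : m * |F.invBranch i x - F.invBranch i y| ≤ |x - y| := by
    rw [he]
    exact mul_le_mul_of_nonneg_right (hle ξ hξ) (abs_nonneg _)
  calc |F.invBranch i x - F.invBranch i y| ≤ m⁻¹ * |x - y| := by
        rwa [le_inv_mul_iff₀ hm0]
    _ ≤ _ := mul_le_mul_of_nonneg_right (by linarith [hε.2]) (abs_nonneg _)

theorem exists_le_invBranch : ∀ᶠ ε in 𝓝[>] (0 : ℝ), ∀ x ∈ Icc l u, ∀ y ∈ Icc l u,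
    ε * |x - y| ≤ |F.invBranch i x - F.invBranch i y| := by
  obtain ⟨M, hM, hle⟩ := F.exists_branchDeriv_le i
  filter_upwards [Ioo_mem_nhdsGT (inv_pos.2 hM)] with ε hε x hx y hy
  obtain ⟨ξ, -, hξ, he⟩ := F.exists_abs_sub_eq_invBranch i hx hy
  calc ε * |x - y| ≤ M⁻¹ * |x - y| := mul_le_mul_of_nonneg_right hε.2.le (abs_nonneg _)
    _ ≤ M⁻¹ * (M * |F.invBranch i x - F.invBranch i y|) := by
        rw [he]
        exact mul_le_mul_of_nonneg_left (mul_le_mul_of_nonneg_right (hle ξ hξ) (abs_nonneg _))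
          (inv_pos.2 hM).le
    _ = _ := inv_mul_cancel_left₀ hM.ne' _

theorem abs_invBranch_sub_le {x y : ℝ} (hx : x ∈ Icc l u) (hy : y ∈ Icc l u) :
    |F.invBranch i x - F.invBranch i y| ≤ |x - y| := by
  obtain ⟨ξ, -, hξ, he⟩ := F.exists_abs_sub_eq_invBranch i hx hy
  rw [he]
  exact le_mul_of_one_le_left (abs_nonneg _) (F.expanding i ξ hξ).le

/-- The increments compare as the derivatives at two mean value points, which lie within `R` of each
other because inverse branches do not increase distances. The additive Hölder error becomes
multiplicative since `|F'| > 1`. -/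
theorem exists_invBranch_distortion {τ : ℝ≥0} (hF : F.IsC1Holder τ) :
    ∀ᶠ H : ℝ in atTop, ∀ R : ℝ, 0 ≤ R → ∀ x ∈ Icc l u, ∀ y ∈ Icc l u, ∀ x' ∈ Icc l u,
      ∀ y' ∈ Icc l u, |x - x'| ≤ R → |x - y'| ≤ R → |y - x'| ≤ R → |y - y'| ≤ R →
      |F.invBranch i x - F.invBranch i y| * |x' - y'| ≤
        Real.exp (H * R ^ (τ : ℝ)) * (|x - y| * |F.invBranch i x' - F.invBranch i y'|) := by
  obtain ⟨C, hC⟩ := hF i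
  filter_upwards [eventually_ge_atTop (C : ℝ)] with H hH R hR x hx y hy x' hx' y' hy' h1 h2 h3 h4
  obtain ⟨ξ, hξu, hξ, he⟩ := F.exists_abs_sub_eq_invBranch i hx hy
  obtain ⟨ξ', hξu', hξ', he'⟩ := F.exists_abs_sub_eq_invBranch i hx' hy'
  have hdist : |ξ' - ξ| ≤ R := by
    rw [abs_sub_comm]
    exact abs_sub_le_of_mem_uIcc ((F.abs_invBranch_sub_le i hx hx').trans h1)
      ((F.abs_invBranch_sub_le i hx hy').trans h2) ((F.abs_invBranch_sub_le i hy hx').trans h3)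
      ((F.abs_invBranch_sub_le i hy hy').trans h4) hξu hξu'
  have hhol : |F.branchDeriv i ξ' - F.branchDeriv i ξ| ≤ C * R ^ (τ : ℝ) :=
    hC.dist_le_of_le hξ' hξ hdist
  have hone : 1 < |F.branchDeriv i ξ| := F.expanding i ξ hξ
  have hRτ : 0 ≤ R ^ (τ : ℝ) := Real.rpow_nonneg hR _
  have hHR : 0 ≤ H * R ^ (τ : ℝ) := mul_nonneg (C.2.trans hH) hRτ
  have hle : |F.branchDeriv i ξ'| ≤ Real.exp (H * R ^ (τ : ℝ)) * |F.branchDeriv i ξ| := by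
    have h5 := abs_sub_abs_le_abs_sub (F.branchDeriv i ξ') (F.branchDeriv i ξ)
    have h6 := mul_le_mul_of_nonneg_right hH hRτ
    have h7 := Real.add_one_le_exp (H * R ^ (τ : ℝ))
    calc |F.branchDeriv i ξ'| ≤ |F.branchDeriv i ξ| + H * R ^ (τ : ℝ) := by linarith
      _ ≤ |F.branchDeriv i ξ| + H * R ^ (τ : ℝ) * |F.branchDeriv i ξ| := by
          have := le_mul_of_one_le_right hHR hone.le
          linarith
      _ = (H * R ^ (τ : ℝ) + 1) * |F.branchDeriv i ξ| := by ring
      _ ≤ _ := mul_le_mul_of_nonneg_right h7 (abs_nonneg _)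
  rw [he, he']
  have := mul_le_mul_of_nonneg_right hle
    (mul_nonneg (abs_nonneg (F.invBranch i x - F.invBranch i y))
      (abs_nonneg (F.invBranch i x' - F.invBranch i y')))
  linarith

theorem exists_gap {i i' : Fin F.q} (h : i ≠ i') :
    ∀ᶠ ε in 𝓝[>] (0 : ℝ), ∀ x ∈ F.piece i, ∀ y ∈ F.piece i', ε ≤ |x - y| := by
  have hi := F.left_lt_right i
  have hi' := F.left_lt_right i'
  have hd := F.disjoint i i' h
  rw [disjoint_left] at hd
  rcases lt_or_ge (F.right i) (F.left i') with h1 | h1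
  · filter_upwards [Ioo_mem_nhdsGT (sub_pos.2 h1)] with ε hε x hx y hy
    rw [abs_sub_comm]
    exact le_trans (by linarith [hε.2, hx.2, hy.1]) (le_abs_self _)
  · rcases lt_or_ge (F.right i') (F.left i) with h2 | h2
    · filter_upwards [Ioo_mem_nhdsGT (sub_pos.2 h2)] with ε hε x hx y hy
      exact le_trans (by linarith [hε.2, hx.1, hy.2]) (le_abs_self _)
    · exact absurd (hd ⟨le_max_left (F.left i) (F.left i'), max_le hi.le h1⟩)
        (not_not.2 ⟨le_max_right _ _, max_le h2 hi'.le⟩)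

end CookieCutterMap

/-- Contractions with summable distortion along words have bounded distortion. -/
theorem foldr_distortion {E : Type*} {φ : E → ℝ → ℝ} {l u θ ρ H τ : ℝ}
    (hmaps : ∀ e, MapsTo (φ e) (Icc l u) (Icc l u)) (hlu : l ≤ u) (hθ0 : 0 < θ) (hθ1 : θ < 1)
    (hle : ∀ e, ∀ x ∈ Icc l u, ∀ y ∈ Icc l u, |φ e x - φ e y| ≤ θ * |x - y|) (hρ : 0 < ρ)
    (hge : ∀ e, ∀ x ∈ Icc l u, ∀ y ∈ Icc l u, ρ * |x - y| ≤ |φ e x - φ e y|) (hH : 0 ≤ H)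
    (hτ : 0 < τ)
    (hdist : ∀ e, ∀ R : ℝ, 0 ≤ R → ∀ x ∈ Icc l u, ∀ y ∈ Icc l u, ∀ x' ∈ Icc l u,
      ∀ y' ∈ Icc l u, |x - x'| ≤ R → |x - y'| ≤ R → |y - x'| ≤ R → |y - y'| ≤ R →
      |φ e x - φ e y| * |x' - y'| ≤ Real.exp (H * R ^ τ) * (|x - y| * |φ e x' - φ e y'|))
    (w : List E) {x y x' y' : ℝ} (hx : x ∈ Icc l u) (hy : y ∈ Icc l u) (hx' : x' ∈ Icc l u)
    (hy' : y' ∈ Icc l u) :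
    |w.foldr φ x - w.foldr φ y| * |x' - y'| ≤
      Real.exp (H * (u - l) ^ τ * (1 - θ ^ τ)⁻¹) *
        (|x - y| * |w.foldr φ x' - w.foldr φ y'|) := by
  have hL : 0 ≤ u - l := sub_nonneg.2 hlu
  have hmem : ∀ (w : List E) {x : ℝ}, x ∈ Icc l u → w.foldr φ x ∈ Icc l u := by
    intro w x hx
    induction w with
    | nil => exact hx
    | cons e w ih => exact hmaps e ih
  have hcontr : ∀ (w : List E) {x y : ℝ}, x ∈ Icc l u → y ∈ Icc l u →
      |w.foldr φ x - w.foldr φ y| ≤ θ ^ w.length * (u - l) := by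
    intro w x y hx hy
    induction w with
    | nil => simpa using abs_sub_le_iff.2 ⟨by linarith [hx.2, hy.1], by linarith [hy.2, hx.1]⟩
    | cons e w ih =>
      rw [List.foldr_cons, List.foldr_cons, List.length_cons, pow_succ', mul_assoc]
      exact (hle e _ (hmem w hx) _ (hmem w hy)).trans (mul_le_mul_of_nonneg_left ih hθ0.le)
  have hexpand : ∀ (w : List E) {x y : ℝ}, x ∈ Icc l u → y ∈ Icc l u →
      ρ ^ w.length * |x - y| ≤ |w.foldr φ x - w.foldr φ y| := by
    intro w x y hx hy
    induction w with
    | nil => simp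
    | cons e w ih =>
      rw [List.foldr_cons, List.foldr_cons, List.length_cons, pow_succ', mul_assoc]
      exact (mul_le_mul_of_nonneg_left ih hρ.le).trans (hge e _ (hmem w hx) _ (hmem w hy))
  have hq0 : 0 ≤ θ ^ τ := Real.rpow_nonneg hθ0.le τ
  have hq1 : θ ^ τ < 1 := Real.rpow_lt_one hθ0.le hθ1 hτ
  have hLτ : 0 ≤ (u - l) ^ τ := Real.rpow_nonneg hL τ
  have key : |w.foldr φ x - w.foldr φ y| * |x' - y'| ≤
      Real.exp (H * (u - l) ^ τ * ∑ i ∈ Finset.range w.length, (θ ^ τ) ^ i) *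
        (|x - y| * |w.foldr φ x' - w.foldr φ y'|) := by
    induction w with
    | nil => simp
    | cons e w ih =>
      -- The inner word has already contracted everything to scale `θ ^ w.length`, so the distortion
      -- exponents form a geometric series.
      have hd := hdist e (θ ^ w.length * (u - l)) (by positivity) _ (hmem w hx) _ (hmem w hy) _
        (hmem w hx') _ (hmem w hy') (hcontr w hx hx') (hcontr w hx hy') (hcontr w hy hx')
        (hcontr w hy hy')
      have hpow : (θ ^ w.length * (u - l)) ^ τ = (u - l) ^ τ * (θ ^ τ) ^ w.length := by
        rw [Real.mul_rpow (by positivity) hL, ← Real.rpow_natCast, ← Real.rpow_natCast,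
          ← Real.rpow_mul hθ0.le, ← Real.rpow_mul hθ0.le, mul_comm τ, mul_comm]
      rw [hpow, ← mul_assoc H] at hd
      have he := hexpand w hx' hy'
      rw [List.foldr_cons, List.foldr_cons, List.foldr_cons, List.foldr_cons, List.length_cons,
        Finset.sum_range_succ, mul_add, Real.exp_add]
      set A := |w.foldr φ x - w.foldr φ y|
      set A' := |w.foldr φ x' - w.foldr φ y'|
      set e₁ := Real.exp (H * (u - l) ^ τ * (θ ^ τ) ^ w.length)
      set e₂ := Real.exp (H * (u - l) ^ τ * ∑ i ∈ Finset.range w.length, (θ ^ τ) ^ i)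
      set B := |φ e (w.foldr φ x) - φ e (w.foldr φ y)|
      set B' := |φ e (w.foldr φ x') - φ e (w.foldr φ y')|
      have he₁ : 0 < e₁ := Real.exp_pos _
      have he₂ : 0 < e₂ := Real.exp_pos _
      have hB' : 0 ≤ B' := abs_nonneg _
      -- The factor `A'` can be cancelled unless it is `0`, and then the lower Lipschitz bound
      -- forces `x' = y'`.
      rcases (abs_nonneg (w.foldr φ x' - w.foldr φ y')).eq_or_lt with h0 | h0
      · have h0' : A' = 0 := h0.symm
        rw [h0'] at he
        have hzero : |x' - y'| = 0 := le_antisymm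
          (nonpos_of_mul_nonpos_right he (pow_pos hρ _)) (abs_nonneg _)
        rw [hzero, mul_zero]
        positivity
      · refine le_of_mul_le_mul_right ?_ h0
        calc B * |x' - y'| * A' = (B * A') * |x' - y'| := by ring
          _ ≤ (e₁ * (A * B')) * |x' - y'| := mul_le_mul_of_nonneg_right hd (abs_nonneg _)
          _ = (e₁ * B') * (A * |x' - y'|) := by ring
          _ ≤ (e₁ * B') * (e₂ * (|x - y| * A')) :=
              mul_le_mul_of_nonneg_left ih (mul_nonneg he₁.le hB')
          _ = _ := by ring
  refine key.trans (mul_le_mul_of_nonneg_right (Real.exp_le_exp.2 ?_) (by positivity))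
  refine mul_le_mul_of_nonneg_left ?_ (mul_nonneg hH hLτ)
  rw [← tsum_geometric_of_lt_one hq0 hq1]
  exact (summable_geometric_of_lt_one hq0 hq1).sum_le_tsum _ fun i _ => by positivity

/-- The inverse branches of a finite system of cookie-cutter maps of class `C^{1+τ}`. -/
theorem exists_separatedIFS {l u : ℝ} (hlu : l < u) {k : ℕ} (F : Fin k → CookieCutterMap l u)
    {τ : ℝ≥0} (hτ : 0 < τ) (hF : ∀ j, (F j).IsC1Holder τ) :
    ∃ S : SeparatedIFS (Σ j, Fin (F j).q) (Fin k) l u,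
      S.lab = Sigma.fst ∧ S.map = fun e => (F e.1).invBranch e.2 := by
  obtain ⟨ε, hε, hε0⟩ := ((eventually_all.2 fun e : Σ j, Fin (F j).q =>
    (F e.1).exists_invBranch_contracting e.2).and self_mem_nhdsWithin).exists
  obtain ⟨ρ, hρ, hρ0⟩ := ((eventually_all.2 fun e : Σ j, Fin (F j).q =>
    (F e.1).exists_le_invBranch e.2).and self_mem_nhdsWithin).exists
  obtain ⟨H, hH, hH0⟩ := ((eventually_all.2 fun e : Σ j, Fin (F j).q =>
    (F e.1).exists_invBranch_distortion e.2 (hF e.1)).and (eventually_ge_atTop 0)).exists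
  have hgap : ∀ j, ∀ i i' : Fin (F j).q, ∀ᶠ g in 𝓝[>] (0 : ℝ), i ≠ i' →
      ∀ x ∈ (F j).piece i, ∀ y ∈ (F j).piece i', g ≤ |x - y| := by
    intro j i i'
    by_cases h : i = i'
    · exact Eventually.of_forall fun _ h' => absurd h h'
    · exact ((F j).exists_gap h).mono fun _ hg _ => hg
  obtain ⟨g, hg, hg0⟩ := ((eventually_all.2 fun j => eventually_all.2 fun i =>
    eventually_all.2 fun i' => hgap j i i').and self_mem_nhdsWithin).exists
  -- The maximum keeps `θ` positive, as `ε` is not known to be below `1`.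
  set θ := max (1 - ε) (1 / 2) with hθ
  have hθ0 : 0 < θ := lt_of_lt_of_le (by norm_num) (le_max_right _ _)
  have hθ1 : θ < 1 := max_lt (by linarith [show 0 < ε from hε0]) (by norm_num)
  have hmaps : ∀ e : Σ j, Fin (F j).q,
      MapsTo ((F e.1).invBranch e.2) (Icc l u) (Icc l u) :=
    fun e x hx => (F e.1).invBranch_mem_Icc e.2 hx
  have hle : ∀ e : Σ j, Fin (F j).q, ∀ x ∈ Icc l u, ∀ y ∈ Icc l u,
      |(F e.1).invBranch e.2 x - (F e.1).invBranch e.2 y| ≤ θ * |x - y| :=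
    fun e x hx y hy => (hε e x hx y hy).trans
      (mul_le_mul_of_nonneg_right (le_max_left _ _) (abs_nonneg _))
  have hq1 : θ ^ (τ : ℝ) < 1 := Real.rpow_lt_one hθ0.le hθ1 hτ
  refine ⟨{
    lt := hlu
    lab := Sigma.fst
    lab_surjective := fun j => ⟨⟨j, 0, (F j).q_pos⟩, rfl⟩
    map := fun e => (F e.1).invBranch e.2
    mapsTo := hmaps
    θ := θ
    θ_pos := hθ0
    θ_lt_one := hθ1
    map_le := hle
    ρ := ρ
    ρ_pos := hρ0
    le_map := hρ
    D := Real.exp (H * (u - l) ^ (τ : ℝ) * (1 - θ ^ (τ : ℝ))⁻¹)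
    one_le_D := Real.one_le_exp (mul_nonneg (mul_nonneg hH0 (Real.rpow_nonneg (by linarith) _))
      (inv_nonneg.2 (by linarith)))
    distortion := fun w x hx y hy x' hx' y' hy' =>
      foldr_distortion hmaps hlu.le hθ0 hθ1 hle hρ0 hρ hH0 hτ hH w hx hy hx' hy'
    g := g
    g_pos := hg0
    gap := ?_ }, rfl, rfl⟩
  rintro ⟨j, i⟩ ⟨j', i'⟩ hne rfl x hx y hy
  exact hg j i i' (fun h => hne (by rw [h])) _ ((F j).invBranch_mem i hx) _
    ((F j).invBranch_mem i' hy)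

/-! ### Coding: limit sets are cookie-cutter-like sets -/

section LimitSet

variable {l u : ℝ} {k : ℕ} {F : Fin k → CookieCutterMap l u}
  {S : SeparatedIFS (Σ j, Fin (F j).q) (Fin k) l u}

theorem SeparatedIFS.mem_words_succ {E ι : Type*} [Fintype E] (S : SeparatedIFS E ι l u)
    {c : ℕ → ι} {n : ℕ} {w : List E} :
    w ∈ S.words c (n + 1) ↔ ∃ v ∈ S.words c n, ∃ e, S.lab e = c n ∧ w = v ++ [e] := by
  constructor
  · intro hw
    obtain ⟨h1, h2⟩ := S.take_drop_mem_words hw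
    obtain ⟨e, he⟩ := List.length_eq_one_iff.1 (S.length_of_mem_words h2)
    refine ⟨_, h1, e, ?_, by rw [← he, List.take_append_drop]⟩
    rw [he, S.mem_words] at h2
    simpa using h2
  · rintro ⟨v, hv, e, he, rfl⟩
    refine S.append_mem_words hv (S.mem_words.2 ?_)
    simp [he]

/-- The first letter is the outermost inverse branch and is undone first by the orbit; the induction
therefore splits off the last letter. -/
theorem seqOrbit_comp (hlab : S.lab = Sigma.fst)
    (hmap : S.map = fun e => (F e.1).invBranch e.2) {c : ℕ → Fin k} {n : ℕ}
    {w : List (Σ j, Fin (F j).q)} (hw : w ∈ S.words c n) {y : ℝ} (hy : y ∈ Icc l u) :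
    seqOrbit F c n (S.comp w y) = y := by
  induction n generalizing w y with
  | zero =>
    rw [List.length_eq_zero_iff.1 (S.length_of_mem_words hw)]
    rfl
  | succ n ih =>
    obtain ⟨v, hv, ⟨j, i⟩, he, rfl⟩ := S.mem_words_succ.1 hw
    rw [hlab] at he
    obtain rfl : j = c n := he
    have h1 : S.comp [⟨c n, i⟩] y = (F (c n)).invBranch i y := by
      rw [SeparatedIFS.comp, hmap]
      rfl
    rw [S.comp_append, seqOrbit, ih hv (S.comp_mem _ hy), h1, (F (c n)).toFun_invBranch i hy]

theorem limitSet_eq_cookieCutterLikeSet (hlab : S.lab = Sigma.fst)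
    (hmap : S.map = fun e => (F e.1).invBranch e.2) (c : ℕ → Fin k) :
    S.limitSet c = cookieCutterLikeSet F c := by
  have hsingle : ∀ (j : Fin k) (i : Fin (F j).q) (y : ℝ),
      S.comp [⟨j, i⟩] y = (F j).invBranch i y := by
    intro j i y
    rw [SeparatedIFS.comp, hmap]
    rfl
  ext x
  constructor
  · intro hx
    constructor
    · obtain ⟨w, _, y, hy, rfl⟩ := hx 0
      exact S.comp_mem w hy
    · intro n
      obtain ⟨w, hw, y, hy, rfl⟩ := hx (n + 1)
      obtain ⟨v, hv, ⟨j, i⟩, he, rfl⟩ := S.mem_words_succ.1 hw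
      rw [hlab] at he
      obtain rfl : j = c n := he
      rw [S.comp_append, seqOrbit_comp hlab hmap hv (S.comp_mem _ hy), hsingle]
      exact mem_iUnion.2 ⟨i, (F (c n)).invBranch_mem i hy⟩
  · rintro ⟨hxI, hx⟩ n
    -- The word records the branches visited by the orbit; naming the orbit point itself as the
    -- preimage makes the induction go through.
    suffices h : seqOrbit F c n x ∈ Icc l u ∧
        ∃ w ∈ S.words c n, S.comp w (seqOrbit F c n x) = x by
      obtain ⟨h1, w, hw, h2⟩ := h
      exact ⟨w, hw, _, h1, h2⟩
    induction n with
    | zero => exact ⟨hxI, [], S.mem_words.2 (by simp), rfl⟩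
    | succ n ih =>
      obtain ⟨_, w, hw, hwx⟩ := ih
      obtain ⟨i, hi⟩ := mem_iUnion.1 (hx n)
      refine ⟨((F (c n)).bijOn i).mapsTo hi, w ++ [⟨c n, i⟩],
        S.mem_words_succ.2 ⟨w, hw, _, by rw [hlab], rfl⟩, ?_⟩
      rw [S.comp_append, hsingle, seqOrbit, (F (c n)).invBranch_toFun i hi, hwx]

theorem cookieCutterSet_eq_cookieCutterLikeSet (F : Fin k → CookieCutterMap l u) (j : Fin k) :
    (F j).cookieCutterSet = cookieCutterLikeSet F fun _ => j := by
  have h : ∀ n x, seqOrbit F (fun _ => j) n x = (F j).toFun^[n] x := by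
    intro n x
    induction n with
    | zero => rfl
    | succ n ih => rw [seqOrbit, ih, Function.iterate_succ_apply']
  simp only [CookieCutterMap.cookieCutterSet, cookieCutterLikeSet, h]

end LimitSet

/-! ### Dimensions in terms of critical exponents -/

namespace SeparatedIFS

variable {l u : ℝ} {k : ℕ} {E : Type*} [Fintype E] (S : SeparatedIFS E (Fin k) l u) {s : ℝ}

theorem summable_Z_const {j : Fin k} (h : S.critExp j < s) : Summable (S.Z s fun _ => j) := by
  obtain ⟨C, b, -, hb, hdec⟩ := S.Z_decay_of_critExp_lt h
  refine Summable.of_nonneg_of_le (fun n => (S.Z_pos s _ n).le) hdec ?_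
  simp_rw [mul_comm (-b), Real.exp_nat_mul]
  exact (summable_geometric_of_lt_one (Real.exp_pos _).le
    (by rw [Real.exp_lt_one_iff]; linarith)).mul_left C

theorem inv_Z_const_le {j : Fin k} (hs : 0 ≤ s) (h : s < S.critExp j) :
    ∃ C, ∀ n, (S.Z s (fun _ => j) n)⁻¹ ≤ C := by
  obtain ⟨C, b, hC, hb, hdec⟩ := S.inv_Z_decay_of_lt_critExp hs h
  refine ⟨C, fun n => (hdec n).trans (mul_le_of_le_one_right (by linarith) ?_)⟩
  rw [Real.exp_le_one_iff, neg_mul, neg_nonpos]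
  positivity

theorem le_dimH_of_inv_Z_le (hs : 0 < s) {c : ℕ → Fin k} {C : ℝ}
    (h : ∀ n, (S.Z s c n)⁻¹ ≤ C) : ENNReal.ofReal s ≤ dimH (S.limitSet c) := by
  have hC : 0 < C := (inv_pos.2 (S.Z_pos s c 0)).trans_le (h 0)
  exact S.le_dimH_limitSet hs (inv_pos.2 hC) fun n =>
    (inv_le_comm₀ hC (S.Z_pos s c n)).2 (h n)

/-- The chain `critExp ≤ dimH ≤ lowerBoxDim ≤ upperBoxDim ≤ critExp` closes up. -/
theorem dimH_limitSet_const (j : Fin k) :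
    dimH (S.limitSet fun _ => j) = ENNReal.ofReal (S.critExp j) ∧
    lowerBoxDim (S.limitSet fun _ => j) = ENNReal.ofReal (S.critExp j) ∧
    upperBoxDim (S.limitSet fun _ => j) = ENNReal.ofReal (S.critExp j) := by
  have h1 : upperBoxDim (S.limitSet fun _ => j) ≤ ENNReal.ofReal (S.critExp j) :=
    le_ofReal_of_forall_lt fun t ht =>
      S.upperBoxDim_limitSet_le ((S.critExp_nonneg j).trans ht.le) (S.summable_Z_const ht)
  have h2 : ENNReal.ofReal (S.critExp j) ≤ dimH (S.limitSet fun _ => j) :=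
    ofReal_le_of_forall_lt fun t ht0 ht => by
      obtain ⟨C, hC⟩ := S.inv_Z_const_le ht0.le ht
      exact S.le_dimH_of_inv_Z_le ht0 hC
  have h3 := dimH_le_lowerBoxDim (S.limitSet fun _ => j)
  have h4 := lowerBoxDim_le_upperBoxDim (S.limitSet fun _ => j)
  exact ⟨le_antisymm (h3.trans (h4.trans h1)) h2, le_antisymm (h4.trans h1) (h2.trans h3),
    le_antisymm h1 (h2.trans (h3.trans h4))⟩

theorem pow_le_exp_abs_log {b : ℝ} (hb : 0 < b) (m : ℕ) :
    b ^ m ≤ Real.exp (|Real.log b| * m) := by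
  conv_lhs => rw [← Real.exp_log hb]
  rw [← Real.exp_nat_mul, mul_comm]
  exact Real.exp_le_exp.2 (mul_le_mul_of_nonneg_right (le_abs_self _) m.cast_nonneg)

variable {c : ℕ → Fin k}

theorem frequently_Z_lt (hc : SwitchesRarely c) (hf : FrequenciesCondition c) {j : Fin k}
    (h : S.critExp j < s) {η : ℝ} (hη : 0 < η) : ∃ᶠ n in atTop, S.Z s c n < η := by
  have hs : 0 ≤ s := (S.critExp_nonneg j).trans h.le
  refine frequently_lt_of_switchesRarely (a := S.Z s) (fun c n => (S.Z_pos s c n).le)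
    (S.Z_congr s) (Real.one_le_rpow S.one_le_D hs) (S.Z_add_le hs)
    -- A crude growth rate for the other labels, from at most `card E ^ m` words of ratio at most
    -- `1`; the `+ 1` keeps the base positive.
    (abs_nonneg (Real.log ((Fintype.card E : ℝ) + 1))) (fun i m => ?_)
    (S.Z_decay_of_critExp_lt h) hc hf hη
  refine (S.Z_le_pow hs _ m).trans (le_trans ?_ (pow_le_exp_abs_log (by positivity) m))
  exact pow_le_pow_left₀ (by positivity) (by linarith) m

theorem frequently_lt_Z (hc : SwitchesRarely c) (hf : FrequenciesCondition c) {j : Fin k}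
    (hs : 0 ≤ s) (h : s < S.critExp j) (M : ℝ) : ∃ᶠ n in atTop, M < S.Z s c n := by
  have hρs : 0 < S.ρ ^ s := Real.rpow_pos_of_pos S.ρ_pos s
  have hfreq := frequently_lt_of_switchesRarely (a := fun c n => (S.Z s c n)⁻¹)
    (fun c n => (inv_pos.2 (S.Z_pos s c n)).le)
    (fun c c' n h => by rw [S.Z_congr s c c' n h]) (Real.one_le_rpow S.one_le_D hs)
    (S.inv_Z_add_le hs) (abs_nonneg (Real.log (S.ρ ^ s)⁻¹)) (fun i m => by
      refine le_trans ?_ (pow_le_exp_abs_log (inv_pos.2 hρs) m)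
      rw [inv_pow]
      exact inv_anti₀ (pow_pos hρs m) (S.pow_le_Z hs _ m))
    (S.inv_Z_decay_of_lt_critExp hs h) hc hf (η := (max M 1)⁻¹)
    (inv_pos.2 (zero_lt_one.trans_le (le_max_right _ _)))
  refine hfreq.mono fun n hn => ?_
  exact (le_max_left _ _).trans_lt
    ((inv_lt_inv₀ (S.Z_pos s c n) (zero_lt_one.trans_le (le_max_right _ _))).1 hn)

theorem summable_Z (hc : SwitchesRarely c) (hs : 0 ≤ s) (h : ∀ j, S.critExp j < s) :
    Summable (S.Z s c) :=
  summable_of_switchesRarely (a := S.Z s) (fun c n => (S.Z_pos s c n).le)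
    (S.Z_congr s) (Real.one_le_rpow S.one_le_D hs) (S.Z_add_le hs)
    (fun j => S.Z_decay_of_critExp_lt (h j)) hc

theorem inv_Z_le (hc : SwitchesRarely c) (hs : 0 ≤ s) (h : ∀ j, s < S.critExp j) :
    ∃ C, ∀ n, (S.Z s c n)⁻¹ ≤ C := by
  have hsum := summable_of_switchesRarely (a := fun c n => (S.Z s c n)⁻¹)
    (fun c n => (inv_pos.2 (S.Z_pos s c n)).le)
    (fun c c' n h => by rw [S.Z_congr s c c' n h]) (Real.one_le_rpow S.one_le_D hs)
    (S.inv_Z_add_le hs) (fun j => S.inv_Z_decay_of_lt_critExp hs (h j)) hc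
  exact ⟨_, fun n => hsum.le_tsum n fun m _ => (inv_pos.2 (S.Z_pos s c m)).le⟩

/-- The frequencies condition gives the upper bound by every `critExp j`; below the smallest one,
rare switching alone keeps `Z` bounded away from `0`. -/
theorem isLeast_dimH_limitSet (hc : SwitchesRarely c) (hf : FrequenciesCondition c) :
    IsLeast (range fun j => ENNReal.ofReal (S.critExp j)) (dimH (S.limitSet c)) := by
  have hle : ∀ j, dimH (S.limitSet c) ≤ ENNReal.ofReal (S.critExp j) := fun j =>
    le_ofReal_of_forall_lt fun t ht =>
      S.dimH_limitSet_le ((S.critExp_nonneg j).trans ht.le) (S.frequently_Z_lt hc hf ht one_pos)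
  have : Nonempty (Fin k) := ⟨c 0⟩
  obtain ⟨j, hj⟩ := Finite.exists_min S.critExp
  refine ⟨⟨j, le_antisymm (ofReal_le_of_forall_lt fun t ht0 ht => ?_) (hle j)⟩, ?_⟩
  · obtain ⟨C, hC⟩ := S.inv_Z_le hc ht0.le fun i => ht.trans_le (hj i)
    exact S.le_dimH_of_inv_Z_le ht0 hC
  · rintro _ ⟨i, rfl⟩
    exact hle i

/-- Dually, the frequencies condition makes `Z` unbounded below each `critExp j`, and rare switching
alone makes it summable above the largest. -/
theorem isGreatest_upperBoxDim_limitSet (hc : SwitchesRarely c) (hf : FrequenciesCondition c) :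
    IsGreatest (range fun j => ENNReal.ofReal (S.critExp j)) (upperBoxDim (S.limitSet c)) := by
  have hle : ∀ j, ENNReal.ofReal (S.critExp j) ≤ upperBoxDim (S.limitSet c) := fun j =>
    ofReal_le_of_forall_lt fun t ht0 ht =>
      S.le_upperBoxDim_limitSet ht0 (S.frequently_lt_Z hc hf ht0.le ht)
  have : Nonempty (Fin k) := ⟨c 0⟩
  obtain ⟨j, hj⟩ := Finite.exists_max S.critExp
  refine ⟨⟨j, le_antisymm (hle j) (le_ofReal_of_forall_lt fun t ht => ?_)⟩, ?_⟩
  · exact S.upperBoxDim_limitSet_le ((S.critExp_nonneg j).trans ht.le)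
      (S.summable_Z hc ((S.critExp_nonneg j).trans ht.le) fun i => (hj i).trans_lt ht)
  · rintro _ ⟨i, rfl⟩
    exact hle i

end SeparatedIFS

theorem mainTheorem5 {A : Type*} {l u : ℝ} (hlu : l < u) {k : ℕ}
    (F : A → Fin k → CookieCutterMap l u)
    (hF : ∀ a, ∃ τ : ℝ≥0, 0 < τ ∧ ∀ j, (F a j).IsC1Holder τ)
    (c : ℕ → Fin k) (hswitch : SwitchesRarely c) (hfreq : FrequenciesCondition c) :
    ∀ a,
      (∀ j, lowerBoxDim (F a j).cookieCutterSet = dimH (F a j).cookieCutterSet ∧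
        upperBoxDim (F a j).cookieCutterSet = dimH (F a j).cookieCutterSet) ∧
      IsLeast (range fun j => dimH (F a j).cookieCutterSet)
        (dimH (cookieCutterLikeSet (F a) c)) ∧
      IsGreatest (range fun j => dimH (F a j).cookieCutterSet)
        (upperBoxDim (cookieCutterLikeSet (F a) c)) := by
  intro a
  obtain ⟨τ, hτ, hτF⟩ := hF a
  obtain ⟨S, hlab, hmap⟩ := exists_separatedIFS hlu (F a) hτ hτF
  have hJ : ∀ j, (F a j).cookieCutterSet = S.limitSet fun _ => j := fun j => by
    rw [cookieCutterSet_eq_cookieCutterLikeSet, limitSet_eq_cookieCutterLikeSet hlab hmap]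
  have hdim : ∀ j, dimH (F a j).cookieCutterSet = ENNReal.ofReal (S.critExp j) := fun j => by
    rw [hJ, (S.dimH_limitSet_const j).1]
  refine ⟨fun j => ?_, ?_⟩
  · rw [hdim, hJ]
    exact (S.dimH_limitSet_const j).2
  · simp only [hdim, ← limitSet_eq_cookieCutterLikeSet hlab hmap]
    exact ⟨S.isLeast_dimH_limitSet hswitch hfreq, S.isGreatest_upperBoxDim_limitSet hswitch hfreq⟩
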